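/- **Setting.** Let $n\ge 1$ workers and dimension $d$ be given. Worker $i$ has a data distribution $\mathcal D_i$ and functions $f_i(\cdot,\xi),g_i(\cdot,\xi):\mathbb R^d\to\mathbb R$ that are convex for every sample $\xi$ and integrable in $\xi\sim\mathcal D_i$; put $f_i(x)=\mathbb E_{\xi\sim\mathcal D_i} f_i(x,\xi)$, $g_i(x)=\mathbb E_{\xi\sim\mathcal D_i}g_i(x,\xi)$, $f=\frac1n\sum_i f_i$, $g=\frac1n\sum_i g_i$. Let $x^*$ minimize $f$ over $\{g\le 0\}$ and let $\|x^0-x^*\|\le R$. The oracles return subgradients $f_i'(x,\xi)$, $g_i'(x,\xi)$ of $f_i(\cdot,\xi)$, $g_i(\cdot,\xi)$ at $x$ with norm at most $M$ (where $M>0$), and unbiased evaluations $\hat g_i(x,\zeta)$ of $g_i(x)$ (for example, mini-batch averages) with $\mathbb E\exp\big((\hat g_i(x,\zeta)-g_i(x))^2/(\sigma^2/N)\big)\le e$ for all $x$, where $\sigma>0$ and $N\ge1$ is the batch size. All samples $\xi_i^t,\zeta_i^t$ are mutually independent (over iterations $t$, over workers $i$, and between subgradients and evaluations). The compressors $\mathcal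 C_i:\mathbb R^d\to\mathbb R^d$ are deterministic with $\|\mathcal C_i(x)-x\|^2\le(1-\delta)\|x\|^2$ for all $x$, where $\delta\in(0,1]$. **Algorithm** (Safe-EF with unidirectional compression, stepsize $\gamma$, threshold $c$). Start from $x^0$ and $e_i^0=0$. For $t=0,\dots,T-1$: put $\hat g^t=\frac1n\sum_i\hat g_i(x^t,\zeta_i^t)$, let $h_i^t=f_i'(x^t,\xi_i^t)$ for all $i$ if $\hat g^t\le c$, and $h_i^t=g_i'(x^t,\xi_i^t)$ for all $i$ otherwise, and set $$v_i^t=\mathcal C_i(e_i^t+h_i^t),\qquad e_i^{t+1}=e_i^t+h_i^t-v_i^t,\qquad x^{t+1}=x^t-\frac{\gamma}{n}\sum_{i=1}^n v_i^t .$$ The output is $\overline x^T=\frac1{|\mathcal B|}\sum_{t\in\mathcal B}x^t$, where $\mathcal B=\{0\le t\le T-1:\hat g^t\le c\}$. **Theorem.** There are absolute constants $\kappa_\gamma,\kappa_c,\kappa_N,\kappa>0$ such that the following holds for all $T\ge1$, all $\beta\in(0,1/2)$, and all problems, oracles and compressors as above. Let $$\gamma=\kappa_\gamma\,\frac{(MR+\sigma/\sqrt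 N)\sqrt\delta}{M^2\sqrt T},\qquad c=\kappa_c\,\frac{(MR+\sigma/\sqrt N)(1+\log\frac1\beta)}{\sqrt{\delta T}},$$ and suppose that the batch size satisfies $N\ge\kappa_N\,(1+\log\frac T\beta)\,\frac{\sigma^2}{nc^2}$. Then, with probability at least $1-2\beta$, the set $\mathcal B$ is non-empty and both $$f(\overline x^T)-f(x^*)\le\kappa\,\frac{(MR+\sigma/\sqrt N)(1+\log\frac1\beta)}{\sqrt{\delta T}}\qquad\text{and}\qquad g(\overline x^T)\le\kappa\,\frac{(MR+\sigma/\sqrt N)(1+\log\frac1\beta)}{\sqrt{\delta T}} .$$ -/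

import Mathlib

open MeasureTheory ProbabilityTheory

noncomputable section

namespace SafeEF

universe u v

/-- `ℝ^d` with the Euclidean norm. -/
abbrev Vec (d : ℕ) : Type := EuclideanSpace ℝ (Fin d)

/-- `v` is a subgradient at `x` of the real function `φ` on `ℝ^d`. -/
def IsSubgradient {d : ℕ} (φ : Vec d → ℝ) (x v : Vec d) : Prop :=
  ∀ y, φ x + inner ℝ v (y - x) ≤ φ y

/-- A deterministic `δ`-contractive compression operator. -/
def IsContractive {d : ℕ} (δ : ℝ) (C : Vec d → Vec d) : Prop :=
  ∀ x, ‖C x - x‖ ^ 2 ≤ (1 - δ) * ‖x‖ ^ 2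

/-- The data of a stochastic distributed constrained problem with `n` workers on `ℝ^d`, together
with the oracles of the workers.  Worker `i` draws samples `ξ` from `distr i` for its subgradients,
and samples `ζ` from `evalDistr i` for its evaluations of the constraint.  A mini-batch estimate is
the special case in which `ζ` is a batch of samples `ξ` and `evalG i x ζ` is the average of
`G i x` over the batch; the use of a single sample is the case `evalG = G`. -/
structure Problem (n d : ℕ) (Ξ : Fin n → Type u) (Z : Fin n → Type v)
    [∀ i, MeasurableSpace (Ξ i)] [∀ i, MeasurableSpace (Z i)] where
  /-- the distribution of the data of worker `i` -/
  distr : ∀ i, Measure (Ξ i)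
  /-- the distribution of the samples with which worker `i` evaluates its constraint -/
  evalDistr : ∀ i, Measure (Z i)
  /-- the stochastic objective `f_i(x, ξ)` -/
  F : ∀ i, Vec d → Ξ i → ℝ
  /-- the stochastic constraint `g_i(x, ξ)` -/
  G : ∀ i, Vec d → Ξ i → ℝ
  /-- the stochastic subgradient `f_i'(x, ξ)` returned by the oracle -/
  F' : ∀ i, Vec d → Ξ i → Vec d
  /-- the stochastic subgradient `g_i'(x, ξ)` returned by the oracle -/
  G' : ∀ i, Vec d → Ξ i → Vec d
  /-- the stochastic evaluation of `g_i(x)` returned by the oracle -/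
  evalG : ∀ i, Vec d → Z i → ℝ

namespace Problem

variable {n d : ℕ} {Ξ : Fin n → Type u} {Z : Fin n → Type v}
  [∀ i, MeasurableSpace (Ξ i)] [∀ i, MeasurableSpace (Z i)]

/-- `f_i(x) = E f_i(x, ξ)`. -/
def fi (P : Problem n d Ξ Z) (i : Fin n) (x : Vec d) : ℝ := ∫ s, P.F i x s ∂(P.distr i)

/-- `g_i(x) = E g_i(x, ξ)`. -/
def gi (P : Problem n d Ξ Z) (i : Fin n) (x : Vec d) : ℝ := ∫ s, P.G i x s ∂(P.distr i)

/-- The objective `f = (1/n) ∑ f_i`. -/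
def f (P : Problem n d Ξ Z) (x : Vec d) : ℝ := (1 / (n : ℝ)) * ∑ i, P.fi i x

/-- The constraint function `g = (1/n) ∑ g_i`. -/
def g (P : Problem n d Ξ Z) (x : Vec d) : ℝ := (1 / (n : ℝ)) * ∑ i, P.gi i x

/-- `x` minimizes `f` over the feasible set `{g ≤ 0}`. -/
def IsSolution (P : Problem n d Ξ Z) (x : Vec d) : Prop :=
  P.g x ≤ 0 ∧ ∀ y, P.g y ≤ 0 → P.f x ≤ P.f y

/-- The stochastic functions are convex and integrable, the oracles return subgradients of them. -/
structure StochConvex (P : Problem n d Ξ Z) : Prop where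
  prob_distr : ∀ i, IsProbabilityMeasure (P.distr i)
  integrable_F : ∀ i x, Integrable (P.F i x) (P.distr i)
  integrable_G : ∀ i x, Integrable (P.G i x) (P.distr i)
  convex_F : ∀ i s, ConvexOn ℝ Set.univ (fun x => P.F i x s)
  convex_G : ∀ i s, ConvexOn ℝ Set.univ (fun x => P.G i x s)
  measurable_F' : ∀ i, Measurable (fun p : Vec d × Ξ i => P.F' i p.1 p.2)
  measurable_G' : ∀ i, Measurable (fun p : Vec d × Ξ i => P.G' i p.1 p.2)
  subgradient_F' : ∀ i x s, IsSubgradient (fun y => P.F i y s) x (P.F' i x s)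
  subgradient_G' : ∀ i x s, IsSubgradient (fun y => P.G i y s) x (P.G' i x s)

/-- The stochastic subgradients are `M`-bounded. -/
def BoundedSubgradients (P : Problem n d Ξ Z) (M : ℝ) : Prop :=
  ∀ i x s, ‖P.F' i x s‖ ^ 2 ≤ M ^ 2 ∧ ‖P.G' i x s‖ ^ 2 ≤ M ^ 2

/-- The evaluations of the constraints are unbiased and sub-Gaussian with parameter `τ`
(which is `σ² / N` for the batch size `N`): `E exp((evalG_i(x, ζ) - g_i(x))² / τ) ≤ e`. -/
structure SubGaussianEval (P : Problem n d Ξ Z) (τ : ℝ) : Prop where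
  prob_evalDistr : ∀ i, IsProbabilityMeasure (P.evalDistr i)
  measurable_evalG : ∀ i, Measurable (fun p : Vec d × Z i => P.evalG i p.1 p.2)
  integrable_evalG : ∀ i x, Integrable (P.evalG i x) (P.evalDistr i)
  unbiased : ∀ i x, ∫ z, P.evalG i x z ∂(P.evalDistr i) = P.gi i x
  subGaussian : ∀ i x,
    ∫⁻ z, ENNReal.ofReal (Real.exp ((P.evalG i x z - P.gi i x) ^ 2 / τ)) ∂(P.evalDistr i)
      ≤ ENNReal.ofReal (Real.exp 1)

/-- The estimate `(1/n) ∑ g_i(x, ζ_i)` of `g(x)` that the server forms. -/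
def estG (P : Problem n d Ξ Z) (x : Vec d) (ζ : ∀ i, Z i) : ℝ :=
  (1 / (n : ℝ)) * ∑ i, P.evalG i x (ζ i)

/-- The stochastic subgradient `h_i` that worker `i` uses: of the objective if the estimated
constraint violation is at most the threshold `c`, of the constraint otherwise. -/
def workerSubgrad (P : Problem n d Ξ Z) (c : ℝ) (x : Vec d) (ξ : ∀ i, Ξ i) (ζ : ∀ i, Z i)
    (i : Fin n) : Vec d :=
  if P.estG x ζ ≤ c then P.F' i x (ξ i) else P.G' i x (ξ i)

/-- Safe-EF with compression from the workers to the server only, run on the realized samples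
`ξ t i` and `ζ t i`: the state after `t` iterations is the model `x^t` together with the errors
`e_i^t` of the workers. -/
def state (P : Problem n d Ξ Z) (C : Fin n → Vec d → Vec d) (γ c : ℝ) (x₀ : Vec d)
    (ξ : ℕ → ∀ i, Ξ i) (ζ : ℕ → ∀ i, Z i) : ℕ → Vec d × (Fin n → Vec d)
  | 0 => (x₀, fun _ => 0)
  | t + 1 =>
    let x := (P.state C γ c x₀ ξ ζ t).1
    let e := (P.state C γ c x₀ ξ ζ t).2
    let h := P.workerSubgrad c x (ξ t) (ζ t)
    let v := fun i => C i (e i + h i)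
    (x - γ • ((1 / (n : ℝ)) • ∑ i, v i), fun i => e i + h i - v i)

/-- The model `x^t`. -/
def iterate (P : Problem n d Ξ Z) (C : Fin n → Vec d → Vec d) (γ c : ℝ) (x₀ : Vec d)
    (ξ : ℕ → ∀ i, Ξ i) (ζ : ℕ → ∀ i, Z i) (t : ℕ) : Vec d :=
  (P.state C γ c x₀ ξ ζ t).1

/-- The iterations `t < T` in which the estimated constraint violation is at most `c`. -/
def goodSteps (P : Problem n d Ξ Z) (C : Fin n → Vec d → Vec d) (γ c : ℝ) (x₀ : Vec d)
    (ξ : ℕ → ∀ i, Ξ i) (ζ : ℕ → ∀ i, Z i) (T : ℕ) : Finset ℕ :=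
  (Finset.range T).filter (fun t => P.estG (P.iterate C γ c x₀ ξ ζ t) (ζ t) ≤ c)

/-- The output: the average of the models `x^t` over the iterations in `goodSteps`. -/
def output (P : Problem n d Ξ Z) (C : Fin n → Vec d → Vec d) (γ c : ℝ) (x₀ : Vec d)
    (ξ : ℕ → ∀ i, Ξ i) (ζ : ℕ → ∀ i, Z i) (T : ℕ) : Vec d :=
  (1 / ((P.goodSteps C γ c x₀ ξ ζ T).card : ℝ)) •
    ∑ t ∈ P.goodSteps C γ c x₀ ξ ζ T, P.iterate C γ c x₀ ξ ζ t

/-- The random samples: `ξ t i` has the law `distr i` and `ζ t i` the law `evalDistr i`, and all of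
them are mutually independent, over iterations, over workers, and between subgradients and
evaluations of the constraint. -/
structure IndepSamples (P : Problem n d Ξ Z) {Ω : Type*} [MeasurableSpace Ω] (μ : Measure Ω)
    (ξ : ℕ → ∀ i, Ω → Ξ i) (ζ : ℕ → ∀ i, Ω → Z i) : Prop where
  law_ξ : ∀ t i, MeasurePreserving (ξ t i) μ (P.distr i)
  law_ζ : ∀ t i, MeasurePreserving (ζ t i) μ (P.evalDistr i)
  indep_pairs : iIndepFun (fun (p : ℕ × Fin n) (ω : Ω) => (ξ p.1 p.2 ω, ζ p.1 p.2 ω)) μ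
  indep_within : ∀ t i, IndepFun (ξ t i) (ζ t i) μ

end Problem

end SafeEF

end

/-!
Safe-EF with unidirectional compression converges with high probability.  Let
`V = ((M R + σ / √N) / M)²`, `L = 1 + log (1 / β)` and `K = V L`.

**Virtual iterates.** The points `x^t - γ e^t`, with `e^t` the average error of the workers, move by
plain steps along the averaged subgradients (`virtualIterate_succ`).  Contractivity keeps `e^t`
bounded by `2 M / δ` and by `M t` (`norm_avgError_le`), so replacing `x^t` by the virtual iterate
costs only `O(K)` in the sum of all steps.

**Comparators.** The usual expansion of the squared distance bounds the regret against any
comparator by the initial squared distance plus noise.  The noise is a martingale whose variance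
grows with the distance to `xstar`, and this distance is not bounded a priori, because an infeasible
iterate may have `f x < f xstar`.  Such an iterate `x^j` is itself useful: by convexity the midpoint
of `x^j` and `xstar` satisfies `f ≤ f xstar` and `g ≤ 9 c / 16`, hence is a valid comparator for
every step.  Using `xstar` before `j` and this midpoint from `j` on improves the bound by half the
squared distance at time `j`, and for the last such `j` before the farthest iterate this outweighs
the noise.  This is `sum_excess_le`, a deterministic statement.

**Noise.** Given the history, the averaged subgradient is sub-Gaussian by Hoeffding's lemma
(`condSubgaussian_noise`), so the exponentials of the relevant scalar and vector martingales,
suitably compensated, are supermartingales, and Ville's inequality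
(`mul_measure_exists_le_lintegral`) bounds them uniformly in time
(`CondSubgaussian.measure_not_noise_le`).  The constraint evaluations are averages of independent
variables with `E exp (X² / τ) ≤ e`, hence sub-Gaussian (`hasSubgaussianMGF_of_lintegral_exp_sq_le`),
and accurate up to `c / 8` in all iterations (`measure_exists_inaccurate_le`).

**Conclusion.** A bad step contributes `γ c / 2` to a sum that is at most `64 K`, while
`T γ c / 2 = 128 K`.  So there are good steps, and at least half of the steps are good unless their
average excess in `f` is negative anyway; Jensen's inequality gives the bounds for the output
(`output_le_of_noise`).
-/

namespace SafeEF

/-! ### Regret of a sequence of inexact subgradient steps -/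

section Deterministic

variable {E : Type*} [NormedAddCommGroup E] [InnerProductSpace ℝ E]

theorem norm_sub_sq_le (a b : E) : ‖a - b‖ ^ 2 ≤ 2 * (‖a‖ ^ 2 + ‖b‖ ^ 2) := by
  have := parallelogram_law_with_norm ℝ a b
  nlinarith [mul_self_nonneg ‖a + b‖]

theorem norm_add_sq_le (a b : E) : ‖a + b‖ ^ 2 ≤ 2 * (‖a‖ ^ 2 + ‖b‖ ^ 2) := by
  simpa using norm_sub_sq_le a (-b)

/-- The regret of the steps `a, …, b - 1` against the comparator `y`, in the coordinates in which
the solution is `0`: `u` is the virtual iterate, `u + p` the model, `m + z` the subgradient with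
mean `m` and noise `z`, and `q` is a lower bound for the linearized excess. -/
theorem sum_le_of_step {T : ℕ} {γ M r : ℝ} {u p m z : ℕ → E} {q : ℕ → ℝ} (hγ : 0 ≤ γ)
    (hstep : ∀ s < T, u (s + 1) = u s - γ • (m s + z s))
    (hh : ∀ s < T, ‖m s + z s‖ ≤ M) (hm : ∀ s < T, ‖m s‖ ≤ M)
    (hr : ∀ s < T, 2 * γ * M * ‖p s‖ + γ ^ 2 * M ^ 2 ≤ r)
    (y : E) {a b : ℕ} (hab : a ≤ b) (hbT : b ≤ T)
    (hq : ∀ s, a ≤ s → s < b → q s ≤ 2 * γ * inner ℝ (m s) (u s + p s - y)) :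
    ∑ s ∈ Finset.Ico a b, q s ≤ ‖u a - y‖ ^ 2 - ‖u b - y‖ ^ 2 + (b - a) * r
      - (∑ s ∈ Finset.range b, 2 * γ * inner ℝ (z s) (u s)
          - ∑ s ∈ Finset.range a, 2 * γ * inner ℝ (z s) (u s))
      + 2 * inner ℝ (∑ s ∈ Finset.range b, γ • z s - ∑ s ∈ Finset.range a, γ • z s) y := by
  induction b, hab using Nat.le_induction with
  | base => simp
  | succ b hab ih =>
    have ih := ih (by omega) (fun s h1 h2 => hq s h1 (by omega))
    have hb : b < T := by omega
    have h1 := hq b hab (by omega)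
    rw [Finset.sum_Ico_succ_top hab, Finset.sum_range_succ, Finset.sum_range_succ, hstep b hb]
    have e1 : ‖u b - γ • (m b + z b) - y‖ ^ 2
        = ‖u b - y‖ ^ 2 - 2 * γ * inner ℝ (m b) (u b + p b - y)
          + 2 * γ * inner ℝ (m b) (p b)
          - 2 * γ * inner ℝ (z b) (u b) + 2 * γ * inner ℝ (z b) y
          + γ ^ 2 * ‖m b + z b‖ ^ 2 := by
      rw [show u b - γ • (m b + z b) - y = (u b - y) - γ • (m b + z b) by abel,
        norm_sub_sq_real, norm_smul, inner_smul_right, real_inner_comm, mul_pow,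
        Real.norm_eq_abs, sq_abs]
      simp only [inner_add_left, inner_add_right, inner_sub_right]
      ring
    have e2 : 2 * γ * inner ℝ (m b) (p b) ≤ 2 * γ * M * ‖p b‖ := by
      have := (real_inner_le_norm (m b) (p b)).trans
        (mul_le_mul_of_nonneg_right (hm b hb) (norm_nonneg (p b)))
      nlinarith
    have e3 : γ ^ 2 * ‖m b + z b‖ ^ 2 ≤ γ ^ 2 * M ^ 2 := by
      gcongr
      exact hh b hb
    have e4 := hr b hb
    rw [e1, show (∑ s ∈ Finset.range b, γ • z s + γ • z b - ∑ s ∈ Finset.range a, γ • z s)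
      = (∑ s ∈ Finset.range b, γ • z s - ∑ s ∈ Finset.range a, γ • z s) + γ • z b by abel,
      inner_add_left, real_inner_smul_left]
    push_cast
    linarith

/-- The excess sum is bounded although the iterates need not stay bounded: a step with `q j < 0`
may move away from the solution.  By `hneg`, the midpoint of such an iterate and the solution is
then an admissible comparator.  Switching to it at the last step `j` of negative excess before the
farthest iterate lowers the bound by about `‖u j‖² / 2`, which absorbs the noise, since by `hS` the
noise is a small multiple of the largest squared distance. -/
theorem sum_excess_le {T : ℕ} {γ M r K : ℝ} {u p m z : ℕ → E} {q : ℕ → ℝ} (hγ : 0 ≤ γ)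
    (hK : 0 ≤ K) (hr0 : 0 ≤ r)
    (hstep : ∀ s < T, u (s + 1) = u s - γ • (m s + z s))
    (hh : ∀ s < T, ‖m s + z s‖ ≤ M) (hm : ∀ s < T, ‖m s‖ ≤ M)
    (hr : ∀ s < T, 2 * γ * M * ‖p s‖ + γ ^ 2 * M ^ 2 ≤ r)
    (hrT : T * r ≤ K / 8) (hp : ∀ s < T, ‖p s‖ ^ 2 ≤ K / 32) (hγM : γ ^ 2 * M ^ 2 ≤ K / 64)
    (hu0 : ‖u 0‖ ^ 2 ≤ K)
    (hq : ∀ s < T, q s ≤ 2 * γ * inner ℝ (m s) (u s + p s))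
    (hneg : ∀ j < T, q j < 0 → ∀ s < T,
      q s ≤ 2 * γ * inner ℝ (m s) (u s + p s - (1 / 2 : ℝ) • (u j + p j)))
    (hS : ∀ D : ℝ, (∀ s ≤ T, ‖u s‖ ≤ D) → ∀ t ≤ T,
      |∑ s ∈ Finset.range t, 2 * γ * inner ℝ (z s) (u s)| ≤ D ^ 2 / 32 + 2 * K)
    (hW : ∀ t ≤ T, ‖∑ s ∈ Finset.range t, γ • z s‖ ^ 2 ≤ 3 * K) :
    ∑ s ∈ Finset.range T, q s ≤ 64 * K := by
  -- `k` is the step at which the distance is largest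
  obtain ⟨k, hkT, hk⟩ : ∃ k ≤ T, ∀ s ≤ T, ‖u s‖ ≤ ‖u k‖ := by
    obtain ⟨k, hk, hmax⟩ := Finset.exists_max_image (Finset.range (T + 1)) (fun s => ‖u s‖)
      ⟨0, by simp⟩
    exact ⟨k, by simpa [Nat.lt_succ_iff] using hk, fun s hs => hmax s (by simp; omega)⟩
  have hS' : ∀ t ≤ T, |∑ s ∈ Finset.range t, 2 * γ * inner ℝ (z s) (u s)| ≤ ‖u k‖ ^ 2 / 32 + 2 * K :=
    hS _ hk
  obtain ⟨S, hSdef⟩ : ∃ S : ℕ → ℝ,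
      ∀ t, S t = ∑ s ∈ Finset.range t, 2 * γ * inner ℝ (z s) (u s) := ⟨_, fun _ => rfl⟩
  obtain ⟨W, hWdef⟩ : ∃ W : ℕ → E, ∀ t, W t = ∑ s ∈ Finset.range t, γ • z s :=
    ⟨_, fun _ => rfl⟩
  simp only [← hSdef] at hS'
  simp only [← hWdef] at hW
  have key : ∀ (y : E) (a b : ℕ), a ≤ b → b ≤ T →
      (∀ s, a ≤ s → s < b → q s ≤ 2 * γ * inner ℝ (m s) (u s + p s - y)) →
      ∑ s ∈ Finset.Ico a b, q s ≤ ‖u a - y‖ ^ 2 - ‖u b - y‖ ^ 2 + (b - a) * r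
        - (S b - S a) + 2 * inner ℝ (W b - W a) y := by
    intro y a b hab hbT h
    simpa only [hSdef, hWdef] using sum_le_of_step hγ hstep hh hm hr y hab hbT h
  have key0 : ∀ a b : ℕ, a ≤ b → b ≤ T →
      ∑ s ∈ Finset.Ico a b, q s ≤ ‖u a‖ ^ 2 - ‖u b‖ ^ 2 + (b - a) * r - (S b - S a) := by
    intro a b hab hbT
    simpa using key 0 a b hab hbT (fun s _ h2 => by simpa using hq s (by omega))
  have hrb : ∀ a b : ℕ, b ≤ T → (b - a : ℝ) * r ≤ K / 8 := by
    intro a b hb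
    refine le_trans (mul_le_mul_of_nonneg_right ?_ hr0) hrT
    have : (b : ℝ) ≤ T := by exact_mod_cast hb
    have : (0 : ℝ) ≤ a := by positivity
    linarith
  obtain ⟨hST, hST'⟩ := abs_le.1 (hS' T le_rfl)
  obtain ⟨hSk, hSk'⟩ := abs_le.1 (hS' k hkT)
  have hS0 : S 0 = 0 := by simp [hSdef]
  by_cases hex : ∃ j, j < k ∧ q j < 0
  · -- `j` is the last step of negative excess before `k`
    obtain ⟨j, ⟨hjk, hqj⟩, hlast⟩ : ∃ j, (j < k ∧ q j < 0) ∧ ∀ i, j < i → i < k → 0 ≤ q i := by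
      obtain ⟨i₀, hi₀⟩ := hex
      obtain ⟨j, hj, hmax⟩ := Finset.exists_max_image
        ((Finset.range k).filter (fun j => q j < 0)) id ⟨i₀, by simpa using hi₀⟩
      refine ⟨j, by simpa using hj, fun i hji hik => ?_⟩
      by_contra hneg
      have := hmax i (by simp; exact ⟨hik, not_le.1 hneg⟩)
      simp at this
      omega
    have hjT : j < T := by omega
    obtain ⟨hSj, hSj'⟩ := abs_le.1 (hS' j hjT.le)
    obtain ⟨hSj1, hSj1'⟩ := abs_le.1 (hS' (j + 1) (by omega))
    -- between `j + 1` and `k` the distance cannot grow by more than the noise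
    have h1 := key0 (j + 1) k (by omega) hkT
    have h2 : 0 ≤ ∑ s ∈ Finset.Ico (j + 1) k, q s :=
      Finset.sum_nonneg fun i hi => by
        rw [Finset.mem_Ico] at hi
        exact hlast i (by omega) hi.2
    have h3 : ‖u (j + 1)‖ ^ 2 ≤ 2 * ‖u j‖ ^ 2 + 2 * (K / 64) := by
      rw [hstep j hjT]
      have a1 := norm_sub_sq_le (u j) (γ • (m j + z j))
      have a2 : ‖γ • (m j + z j)‖ ^ 2 ≤ γ ^ 2 * M ^ 2 := by
        rw [norm_smul, mul_pow, Real.norm_eq_abs, sq_abs]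
        gcongr
        exact hh j hjT
      linarith
    have h4 := hrb (j + 1) k hkT
    -- the comparator is `0` up to step `j` and the midpoint `y` of `0` and the `j`-th iterate after
    set y : E := (1 / 2 : ℝ) • (u j + p j) with hy
    have h5 := key0 0 j (by omega) hjT.le
    have h6 := key y j T hjT.le le_rfl (fun s _ h => hneg j hjT hqj s h)
    have h7 : ‖u j - y‖ ^ 2 ≤ (‖u j‖ ^ 2 + ‖p j‖ ^ 2) / 2 := by
      have : u j - y = (1 / 2 : ℝ) • (u j - p j) := by rw [hy]; module
      rw [this, norm_smul, mul_pow]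
      have := norm_sub_sq_le (u j) (p j)
      norm_num
      linarith
    have h8 : ‖y‖ ^ 2 ≤ (‖u j‖ ^ 2 + ‖p j‖ ^ 2) / 2 := by
      rw [hy, norm_smul, mul_pow]
      have := norm_add_sq_le (u j) (p j)
      norm_num
      linarith
    have h9 : ‖W T - W j‖ ^ 2 ≤ 12 * K := by
      have := norm_sub_sq_le (W T) (W j)
      have b1 := hW T le_rfl
      have b2 := hW j hjT.le
      linarith
    have h10 : 2 * inner ℝ (W T - W j) y ≤ ‖y‖ ^ 2 / 4 + 48 * K := by
      have c1 := real_inner_le_norm (W T - W j) y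
      have c2 := sq_nonneg (‖y‖ / 2 - 2 * ‖W T - W j‖)
      have c3 : (‖y‖ / 2 - 2 * ‖W T - W j‖) ^ 2
          = ‖y‖ ^ 2 / 4 - 2 * (‖W T - W j‖ * ‖y‖) + 4 * ‖W T - W j‖ ^ 2 := by ring
      linarith
    have h11 := hp j hjT
    have h12 : ∑ s ∈ Finset.range T, q s
        = ∑ s ∈ Finset.Ico 0 j, q s + ∑ s ∈ Finset.Ico j T, q s := by
      rw [Finset.sum_Ico_consecutive _ (by omega) hjT.le, Finset.range_eq_Ico]
    have h13 : (j - (0 : ℕ) : ℝ) * r + (T - j) * r ≤ K / 8 := by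
      push_cast
      linarith
    have h14 : 0 ≤ ‖u T - y‖ ^ 2 := by positivity
    rw [hS0] at h5
    simp only [Nat.cast_zero, sub_zero] at h5 h13
    rw [h12]
    linarith
  · push Not at hex
    have h1 := key0 0 k (by omega) hkT
    have h2 := key0 0 T (by omega) le_rfl
    have h3 := hrb 0 k hkT
    have h4 := hrb 0 T le_rfl
    have h5 : 0 ≤ ∑ s ∈ Finset.Ico 0 k, q s :=
      Finset.sum_nonneg fun i hi => hex i (Finset.mem_Ico.1 hi).2
    have h6 : 0 ≤ ‖u T‖ ^ 2 := by positivity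
    rw [hS0] at h1 h2
    simp only [Nat.cast_zero, sub_zero] at h1 h2 h3 h4
    rw [Finset.range_eq_Ico]
    linarith

end Deterministic

/-! ### Error feedback and virtual iterates -/

section ErrorFeedback

universe u v

theorem norm_average_le {E : Type*} [NormedAddCommGroup E] [NormedSpace ℝ E] {n : ℕ} (hn : 0 < n)
    {a : Fin n → E} {B : ℝ} (ha : ∀ i, ‖a i‖ ≤ B) : ‖(1 / (n : ℝ)) • ∑ i, a i‖ ≤ B := by
  have hn' : (0 : ℝ) < n := by exact_mod_cast hn
  rw [norm_smul, Real.norm_of_nonneg (by positivity), one_div, inv_mul_le_iff₀ hn']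
  exact (norm_sum_le _ _).trans ((Finset.sum_le_sum fun i _ => ha i).trans (by simp))

/-- One step of error feedback: a contractive compressor shrinks the norm by `1 - δ / 2`. -/
theorem IsContractive.norm_sub_le {d : ℕ} {δ : ℝ} {C : Vec d → Vec d} (hC : IsContractive δ C)
    (hδ : δ ≤ 1) (a : Vec d) : ‖a - C a‖ ≤ (1 - δ / 2) * ‖a‖ := by
  refine abs_le_of_sq_le_sq' ?_ (by have := norm_nonneg a; nlinarith) |>.2
  rw [norm_sub_rev]
  nlinarith [hC a, mul_nonneg (sq_nonneg δ) (sq_nonneg ‖a‖)]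

namespace Problem

variable {n d : ℕ} {Ξ : Fin n → Type u} {Z : Fin n → Type v}
  [∀ i, MeasurableSpace (Ξ i)] [∀ i, MeasurableSpace (Z i)]
  (P : Problem n d Ξ Z) (C : Fin n → Vec d → Vec d) (γ c : ℝ) (x₀ : Vec d)
  (ξ : ℕ → ∀ i, Ξ i) (ζ : ℕ → ∀ i, Z i)

/-- The average `(1/n) ∑ e_i^t` of the errors of the workers. -/
noncomputable def avgError (t : ℕ) : Vec d := (1 / (n : ℝ)) • ∑ i, (P.state C γ c x₀ ξ ζ t).2 i

/-- The average `(1/n) ∑ h_i` of the subgradients that the workers use. -/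
noncomputable def avgSubgrad (x : Vec d) (ξ : ∀ i, Ξ i) (ζ : ∀ i, Z i) : Vec d :=
  (1 / (n : ℝ)) • ∑ i, P.workerSubgrad c x ξ ζ i

/-- The virtual iterate `x^t - γ e^t`, which moves by uncompressed subgradient steps. -/
noncomputable def virtualIterate (t : ℕ) : Vec d :=
  P.iterate C γ c x₀ ξ ζ t - γ • P.avgError C γ c x₀ ξ ζ t

variable {P C γ c x₀ ξ ζ} {M δ : ℝ}

theorem virtualIterate_zero : P.virtualIterate C γ c x₀ ξ ζ 0 = x₀ := by
  simp [virtualIterate, iterate, avgError, state]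

theorem virtualIterate_succ (t : ℕ) :
    P.virtualIterate C γ c x₀ ξ ζ (t + 1) = P.virtualIterate C γ c x₀ ξ ζ t
      - γ • P.avgSubgrad c (P.iterate C γ c x₀ ξ ζ t) (ξ t) (ζ t) := by
  simp only [virtualIterate, iterate, avgError, avgSubgrad, state, Finset.sum_sub_distrib,
    Finset.sum_add_distrib]
  module

theorem BoundedSubgradients.norm_workerSubgrad_le (hM : 0 ≤ M) (hP : P.BoundedSubgradients M)
    (x : Vec d) (ξ : ∀ i, Ξ i) (ζ : ∀ i, Z i) (i : Fin n) :
    ‖P.workerSubgrad c x ξ ζ i‖ ≤ M := by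
  unfold workerSubgrad
  split_ifs
  · exact abs_le_of_sq_le_sq' (hP i x (ξ i)).1 hM |>.2
  · exact abs_le_of_sq_le_sq' (hP i x (ξ i)).2 hM |>.2

theorem BoundedSubgradients.norm_avgSubgrad_le (hn : 0 < n) (hM : 0 ≤ M)
    (hP : P.BoundedSubgradients M) (x : Vec d) (ξ : ∀ i, Ξ i) (ζ : ∀ i, Z i) :
    ‖P.avgSubgrad c x ξ ζ‖ ≤ M :=
  norm_average_le hn fun i => hP.norm_workerSubgrad_le hM x ξ ζ i

theorem norm_error_succ_le (hM : 0 ≤ M) (hP : P.BoundedSubgradients M) (hδ1 : δ ≤ 1)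
    (hC : ∀ i, IsContractive δ (C i)) (t : ℕ) (i : Fin n) :
    ‖(P.state C γ c x₀ ξ ζ (t + 1)).2 i‖
      ≤ (1 - δ / 2) * (‖(P.state C γ c x₀ ξ ζ t).2 i‖ + M) := by
  refine ((hC i).norm_sub_le hδ1 _).trans ?_
  gcongr
  · linarith
  · exact (norm_add_le _ _).trans (by gcongr; exact hP.norm_workerSubgrad_le hM _ _ _ _)

/-- The bound `M * t` is the sharper one as long as `t < 2 / δ`; the product of the two bounds is
what controls the distance between the model and the virtual iterate for every horizon. -/
theorem norm_avgError_le (hn : 0 < n) (hM : 0 ≤ M) (hP : P.BoundedSubgradients M) (hδ : 0 < δ)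
    (hδ1 : δ ≤ 1) (hC : ∀ i, IsContractive δ (C i)) (t : ℕ) :
    ‖P.avgError C γ c x₀ ξ ζ t‖ ≤ 2 * M / δ ∧ ‖P.avgError C γ c x₀ ξ ζ t‖ ≤ M * t := by
  suffices h : ∀ i, ‖(P.state C γ c x₀ ξ ζ t).2 i‖ ≤ 2 * M / δ ∧
      ‖(P.state C γ c x₀ ξ ζ t).2 i‖ ≤ M * t from
    ⟨norm_average_le hn fun i => (h i).1, norm_average_le hn fun i => (h i).2⟩
  intro i
  induction t with
  | zero =>
    have : 0 ≤ 2 * M / δ := by positivity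
    simpa [state] using this
  | succ t ih =>
    have h := norm_error_succ_le (γ := γ) (c := c) (x₀ := x₀) (ξ := ξ) (ζ := ζ) hM hP hδ1 hC t i
    constructor
    · calc _ ≤ (1 - δ / 2) * (2 * M / δ + M) := h.trans (by gcongr; exacts [by linarith, ih.1])
        _ = 2 * M / δ - M * δ / 2 := by field_simp; ring
        _ ≤ 2 * M / δ := by have : 0 ≤ M * δ / 2 := by positivity
                            linarith
    · calc _ ≤ 1 * (M * t + M) := h.trans (by gcongr; exacts [by linarith, ih.2])
        _ = M * (t + 1 : ℕ) := by push_cast; ring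

end Problem

end ErrorFeedback

/-! ### Maximal inequalities for the noise -/

section Concentration

open scoped ENNReal

variable {Ω : Type*} {mΩ : MeasurableSpace Ω} {μ : Measure Ω}

/-- Ville's maximal inequality for nonnegative supermartingales. -/
theorem mul_measure_exists_le_lintegral {𝓕 : Filtration ℕ mΩ} {Y : ℕ → Ω → ℝ≥0∞} {T : ℕ}
    (hY : ∀ t, Measurable[𝓕 t] (Y t))
    (hsup : ∀ t < T, ∀ A, MeasurableSet[𝓕 t] A → ∫⁻ ω in A, Y (t + 1) ω ∂μ ≤ ∫⁻ ω in A, Y t ω ∂μ)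
    (a : ℝ≥0∞) :
    a * μ {ω | ∃ t ≤ T, a ≤ Y t ω} ≤ ∫⁻ ω, Y 0 ω ∂μ := by
  set B : ℕ → Set Ω := fun k => {ω | ∃ t ≤ k, a ≤ Y t ω} with hB
  have hBm : ∀ k, MeasurableSet[𝓕 k] (B k) := by
    intro k
    have : B k = ⋃ t ∈ Set.Iic k, {ω | a ≤ Y t ω} := by ext ω; simp [hB]
    rw [this]
    refine MeasurableSet.biUnion (Set.to_countable _) fun t ht => ?_
    exact 𝓕.mono ht _ ((hY t) measurableSet_Ici)
  have hYm : ∀ t, Measurable (Y t) := fun t => (hY t).mono (𝓕.le t) le_rfl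
  have key : ∀ k ≤ T, a * μ (B k) + ∫⁻ ω in (B k)ᶜ, Y k ω ∂μ ≤ ∫⁻ ω, Y 0 ω ∂μ := by
    intro k hk
    induction k with
    | zero =>
      rw [← lintegral_add_compl (μ := μ) (Y 0) (𝓕.le 0 _ (hBm 0))]
      refine add_le_add (?_ : _ ≤ ∫⁻ ω in B 0, Y 0 ω ∂μ) le_rfl
      rw [← setLIntegral_const]
      exact setLIntegral_mono' (𝓕.le 0 _ (hBm 0)) fun ω hω => by simpa [hB] using hω
    | succ k ih =>
      refine le_trans ?_ (ih (by omega))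
      have h1 := hsup k (by omega) _ (hBm k).compl
      set A := {ω | a ≤ Y (k + 1) ω} with hA
      have hAm : MeasurableSet A := (hYm (k + 1)) measurableSet_Ici
      have hBs : B (k + 1) = B k ∪ ((B k)ᶜ ∩ A) := by
        ext ω
        simp only [hB, hA, Set.mem_ofPred_eq, Set.mem_union, Set.mem_inter_iff, Set.mem_compl_iff]
        constructor
        · rintro ⟨t, ht, h⟩
          by_cases hex : ∃ t ≤ k, a ≤ Y t ω
          · exact Or.inl hex
          · refine Or.inr ⟨hex, ?_⟩
            rcases Nat.lt_or_ge t (k + 1) with h' | h'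
            · exact absurd ⟨t, by omega, h⟩ hex
            · rwa [show k + 1 = t by omega]
        · rintro (⟨t, ht, h⟩ | ⟨_, h⟩)
          · exact ⟨t, by omega, h⟩
          · exact ⟨k + 1, le_rfl, h⟩
      have hBc : (B (k + 1))ᶜ = (B k)ᶜ ∩ Aᶜ := by
        rw [hBs]; ext ω; simp; tauto
      have hBk := (𝓕.le k _ (hBm k)).compl
      rw [hBc]
      have h2 : a * μ (B (k + 1)) ≤ a * μ (B k) + ∫⁻ ω in (B k)ᶜ ∩ A, Y (k + 1) ω ∂μ := by
        rw [hBs]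
        refine (mul_le_mul_right (measure_union_le _ _) a).trans ?_
        rw [mul_add]
        gcongr
        rw [← setLIntegral_const]
        exact setLIntegral_mono' (hBk.inter hAm) fun ω hω => hω.2
      calc a * μ (B (k + 1)) + ∫⁻ ω in (B k)ᶜ ∩ Aᶜ, Y (k + 1) ω ∂μ
          ≤ a * μ (B k) + (∫⁻ ω in (B k)ᶜ ∩ A, Y (k + 1) ω ∂μ
              + ∫⁻ ω in (B k)ᶜ ∩ Aᶜ, Y (k + 1) ω ∂μ) := by
            rw [← add_assoc]; gcongr
        _ = a * μ (B k) + ∫⁻ ω in (B k)ᶜ, Y (k + 1) ω ∂μ := by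
            rw [← lintegral_inter_add_sdiff _ (B k)ᶜ hAm]; rfl
        _ ≤ _ := by gcongr
  exact (le_self_add).trans (key T le_rfl)

variable {E : Type*} [NormedAddCommGroup E] [InnerProductSpace ℝ E] [MeasurableSpace E]

/-- The vectors `z t` are, conditionally on `𝓕 t`, sub-Gaussian with parameter `M ^ 2` in every
direction: `E[exp (⟨z t, v⟩ - M² ‖v‖² / 2) | 𝓕 t] ≤ 1` for `𝓕 t`-measurable `v`.  The conditional
expectation is expressed by integration against nonnegative `𝓕 t`-measurable weights `ρ`. -/
def CondSubgaussian (μ : Measure Ω) (𝓕 : Filtration ℕ mΩ) (z : ℕ → Ω → E) (M : ℝ) : Prop :=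
  ∀ t (ρ : Ω → ℝ≥0∞) (v : Ω → E), Measurable[𝓕 t] ρ → Measurable[𝓕 t] v →
    ∫⁻ ω, ρ ω * ENNReal.ofReal (Real.exp (inner ℝ (z t ω) (v ω) - M ^ 2 * ‖v ω‖ ^ 2 / 2)) ∂μ
      ≤ ∫⁻ ω, ρ ω ∂μ

/-- Ville's inequality for a process `X` whose increments are dominated by the exponents in
`CondSubgaussian`, so that `exp (X t)` is a supermartingale. -/
theorem CondSubgaussian.measure_exists_le [IsProbabilityMeasure μ] {𝓕 : Filtration ℕ mΩ}
    {z : ℕ → Ω → E} {M : ℝ} (hz : CondSubgaussian μ 𝓕 z M) {v : ℕ → Ω → E}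
    (hv : ∀ t, Measurable[𝓕 t] (v t)) {X : ℕ → Ω → ℝ} (hX : ∀ t, Measurable[𝓕 t] (X t)) {T : ℕ}
    (hX0 : ∀ ω, X 0 ω ≤ 0)
    (hstep : ∀ t < T, ∀ ω, X (t + 1) ω ≤
      X t ω + (inner ℝ (z t ω) (v t ω) - M ^ 2 * ‖v t ω‖ ^ 2 / 2)) {β : ℝ} (hβ : 0 < β) :
    μ {ω | ∃ t ≤ T, Real.log (1 / β) ≤ X t ω} ≤ ENNReal.ofReal β := by
  have h := mul_measure_exists_le_lintegral (μ := μ) (𝓕 := 𝓕) (T := T)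
    (Y := fun t ω => ENNReal.ofReal (Real.exp (X t ω)))
    (fun t => (Real.measurable_exp.comp (hX t)).ennreal_ofReal) ?_ (ENNReal.ofReal (1 / β))
  · have h1 : ∫⁻ ω, ENNReal.ofReal (Real.exp (X 0 ω)) ∂μ ≤ 1 := by
      calc _ ≤ ∫⁻ _, 1 ∂μ := lintegral_mono fun ω => by
            simpa using hX0 ω
        _ = 1 := by simp
    have h2 : {ω | ∃ t ≤ T, Real.log (1 / β) ≤ X t ω}
        = {ω | ∃ t ≤ T, ENNReal.ofReal (1 / β) ≤ ENNReal.ofReal (Real.exp (X t ω))} := by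
      ext ω
      simp only [Set.mem_ofPred_eq]
      refine exists_congr fun t => and_congr_right fun _ => ?_
      rw [ENNReal.ofReal_le_ofReal_iff (Real.exp_nonneg _),
        Real.log_le_iff_le_exp (by positivity)]
    rw [h2]
    calc _ = ENNReal.ofReal β * (ENNReal.ofReal (1 / β) * μ _) := by
          rw [← mul_assoc, ← ENNReal.ofReal_mul hβ.le, mul_one_div_cancel hβ.ne',
            ENNReal.ofReal_one, one_mul]
      _ ≤ ENNReal.ofReal β * 1 := by gcongr; exact h.trans h1
      _ = _ := mul_one _
  · intro t ht A hA
    have h3 := hz t (A.indicator fun ω => ENNReal.ofReal (Real.exp (X t ω))) (v t)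
      ((Real.measurable_exp.comp (hX t)).ennreal_ofReal.indicator hA) (hv t)
    rw [← lintegral_indicator (𝓕.le t _ hA), ← lintegral_indicator (𝓕.le t _ hA)]
    refine le_trans (lintegral_mono fun ω => ?_) h3
    by_cases hω : ω ∈ A
    · simp only [Set.indicator_of_mem hω]
      rw [← ENNReal.ofReal_mul (Real.exp_nonneg _), ← Real.exp_add]
      exact ENNReal.ofReal_le_ofReal (Real.exp_le_exp.2 (hstep t ht ω))
    · simp [Set.indicator_of_notMem hω]

variable [BorelSpace E] [SecondCountableTopology E]

/-- The scalar martingale `∑ 2 γ ⟨z s, u s⟩`, up to the sign `ε`.  Its variance is proportional to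
the largest squared distance `D²`, on which no a priori bound is needed. -/
theorem CondSubgaussian.measure_sum_inner [IsProbabilityMeasure μ] {𝓕 : Filtration ℕ mΩ}
    {z u : ℕ → Ω → E} {M γ V β : ℝ} {T : ℕ} (hV : 0 < V) (hβ : 0 < β)
    (hz : CondSubgaussian μ 𝓕 z M) (hzm : ∀ t, Measurable[𝓕 (t + 1)] (z t))
    (hu : ∀ t, Measurable[𝓕 t] (u t)) (hG : γ ^ 2 * M ^ 2 * T ≤ V / 64) {ε : ℝ} (hε : ε ^ 2 = 1) :
    μ {ω | ∃ D, (∀ s ≤ T, ‖u s ω‖ ≤ D) ∧ ∃ t ≤ T, D ^ 2 / 32 + V * Real.log (1 / β) ≤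
      ε * ∑ s ∈ Finset.range t, 2 * γ * inner ℝ (z s ω) (u s ω)} ≤ ENNReal.ofReal β := by
  set v : ℕ → Ω → E := fun t ω => (ε * (2 * γ / V)) • u t ω with hv
  have hvm : ∀ t, Measurable[𝓕 t] (v t) := fun t => (hu t).const_smul _
  set X : ℕ → Ω → ℝ := fun t ω =>
    ∑ s ∈ Finset.range t, (inner ℝ (z s ω) (v s ω) - M ^ 2 * ‖v s ω‖ ^ 2 / 2) with hX
  have hXm : ∀ t, Measurable[𝓕 t] (X t) := by
    intro t
    refine Finset.measurable_fun_sum _ fun s hs => ?_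
    have hs' : s < t := Finset.mem_range.1 hs
    have h1 : Measurable[𝓕 t] (z s) := (hzm s).mono (𝓕.mono hs') le_rfl
    have h2 : Measurable[𝓕 t] (v s) := (hvm s).mono (𝓕.mono hs'.le) le_rfl
    exact (h1.inner h2).sub ((((measurable_norm.comp h2).pow_const 2).const_mul _).div_const 2)
  refine le_trans (measure_mono ?_) (hz.measure_exists_le hvm hXm (T := T) (by simp [hX])
    (fun t _ ω => (Finset.sum_range_succ _ t).le) hβ)
  rintro ω ⟨D, hD, t, ht, h⟩
  refine ⟨t, ht, ?_⟩
  have h1 : X t ω = (ε * ∑ s ∈ Finset.range t, 2 * γ * inner ℝ (z s ω) (u s ω)) / V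
      - ∑ s ∈ Finset.range t, 2 * (γ ^ 2 * M ^ 2) * ‖u s ω‖ ^ 2 / V ^ 2 := by
    rw [hX, Finset.mul_sum, Finset.sum_div, ← Finset.sum_sub_distrib]
    refine Finset.sum_congr rfl fun s _ => ?_
    simp only [hv, inner_smul_right, norm_smul, mul_pow, Real.norm_eq_abs, sq_abs, hε]
    field_simp
  have h2 : ∑ s ∈ Finset.range t, 2 * (γ ^ 2 * M ^ 2) * ‖u s ω‖ ^ 2 / V ^ 2 ≤ D ^ 2 / 32 / V := by
    calc _ ≤ ∑ s ∈ Finset.range t, 2 * (γ ^ 2 * M ^ 2) * D ^ 2 / V ^ 2 := by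
          refine Finset.sum_le_sum fun s hs => ?_
          have := hD s ((Finset.mem_range.1 hs).le.trans ht)
          gcongr
      _ = 2 * (γ ^ 2 * M ^ 2 * t) * D ^ 2 / V ^ 2 := by simp; ring
      _ ≤ 2 * (γ ^ 2 * M ^ 2 * T) * D ^ 2 / V ^ 2 := by gcongr
      _ ≤ 2 * (V / 64) * D ^ 2 / V ^ 2 := by gcongr
      _ = _ := by field_simp; ring
  have h3 : D ^ 2 / 32 / V + Real.log (1 / β)
      ≤ (ε * ∑ s ∈ Finset.range t, 2 * γ * inner ℝ (z s ω) (u s ω)) / V := by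
    rw [le_div_iff₀ hV]
    calc _ = D ^ 2 / 32 + V * Real.log (1 / β) := by field_simp
      _ ≤ _ := h
  linarith

/-- The vector martingale `∑ γ z s`.  The exponent is `‖·‖² / V` with a weight that decreases from
`2` to `1`, which pays for the conditional variance of the cross terms. -/
theorem CondSubgaussian.measure_norm_sum [IsProbabilityMeasure μ] {𝓕 : Filtration ℕ mΩ}
    {z : ℕ → Ω → E} {M γ V β : ℝ} {T : ℕ} (hT : 0 < T) (hV : 0 < V) (hβ : 0 < β)
    (hz : CondSubgaussian μ 𝓕 z M) (hzm : ∀ t, Measurable[𝓕 (t + 1)] (z t))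
    (hzM : ∀ t ω, ‖z t ω‖ ≤ 2 * M) (hG : γ ^ 2 * M ^ 2 * T ≤ V / 64) :
    μ {ω | ∃ t ≤ T, V * (Real.log (1 / β) + 1 / 8) ≤ ‖∑ s ∈ Finset.range t, γ • z s ω‖ ^ 2}
      ≤ ENNReal.ofReal β := by
  have hT' : (0 : ℝ) < T := by exact_mod_cast hT
  set W : ℕ → Ω → E := fun t ω => ∑ s ∈ Finset.range t, γ • z s ω with hW
  set l : ℕ → ℝ := fun t => (2 - t / T) / V with hl
  set v : ℕ → Ω → E := fun t ω => (2 * l (t + 1) * γ) • W t ω with hv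
  have hWm : ∀ t, Measurable[𝓕 t] (W t) := fun t =>
    Finset.measurable_fun_sum _ fun s hs =>
      ((hzm s).mono (𝓕.mono (Finset.mem_range.1 hs)) le_rfl).const_smul γ
  set X : ℕ → Ω → ℝ := fun t ω => l t * ‖W t ω‖ ^ 2 - 8 * t * (γ ^ 2 * M ^ 2) / V with hX
  refine le_trans (measure_mono ?_) (hz.measure_exists_le (v := v)
    (fun t => (hWm t).const_smul _) (X := X)
    (fun t => (((measurable_norm.comp (hWm t)).pow_const 2).const_mul _).sub_const _) (T := T)
    (by simp [hX, hW]) ?_ hβ)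
  · rintro ω ⟨t, ht, h⟩
    refine ⟨t, ht, ?_⟩
    have ht' : (t : ℝ) / T ≤ 1 := by
      rw [div_le_one hT']; exact_mod_cast ht
    have h1 : ‖W t ω‖ ^ 2 / V ≤ l t * ‖W t ω‖ ^ 2 := by
      rw [hl, div_mul_eq_mul_div]
      gcongr
      nlinarith [sq_nonneg ‖W t ω‖]
    have h2 : 8 * t * (γ ^ 2 * M ^ 2) / V ≤ 1 / 8 := by
      rw [div_le_iff₀ hV]
      have : (t : ℝ) * (γ ^ 2 * M ^ 2) ≤ T * (γ ^ 2 * M ^ 2) := by gcongr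
      linarith
    have h3 : Real.log (1 / β) + 1 / 8 ≤ ‖W t ω‖ ^ 2 / V := by
      rw [le_div_iff₀ hV]; linarith
    linarith
  · intro t ht ω
    have h1 : W (t + 1) ω = W t ω + γ • z t ω := by simp [hW, Finset.sum_range_succ]
    have ht' : ((t + 1 : ℕ) : ℝ) / T ≤ 1 := by
      rw [div_le_one hT']; exact_mod_cast ht
    have hl0 : 0 ≤ l (t + 1) := by
      have : 0 ≤ 2 - ((t + 1 : ℕ) : ℝ) / T := by linarith
      positivity
    have hl2 : l (t + 1) ≤ 2 / V := by
      have : 0 ≤ ((t + 1 : ℕ) : ℝ) / T := by positivity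
      simp only [hl]
      gcongr
      linarith
    have h2 : l t = l (t + 1) + 1 / (V * T) := by
      simp only [hl]; push_cast; field_simp; ring
    have h3 : ‖W (t + 1) ω‖ ^ 2 ≤ ‖W t ω‖ ^ 2 + 2 * γ * inner ℝ (z t ω) (W t ω)
        + 4 * (γ ^ 2 * M ^ 2) := by
      have : ‖z t ω‖ ^ 2 ≤ (2 * M) ^ 2 := by gcongr; exact hzM t ω
      rw [h1, norm_add_sq_real, inner_smul_right, norm_smul, mul_pow, Real.norm_eq_abs, sq_abs,
        real_inner_comm]
      nlinarith [mul_le_mul_of_nonneg_left this (sq_nonneg γ)]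
    have h4 : l (t + 1) * (4 * (γ ^ 2 * M ^ 2)) ≤ 8 * (γ ^ 2 * M ^ 2) / V := by
      calc _ ≤ 2 / V * (4 * (γ ^ 2 * M ^ 2)) := by gcongr
        _ = _ := by ring
    have h5 : M ^ 2 * ‖v t ω‖ ^ 2 / 2 ≤ 1 / (V * T) * ‖W t ω‖ ^ 2 := by
      have e1 : M ^ 2 * ‖v t ω‖ ^ 2 / 2
          = 2 * l (t + 1) ^ 2 * (γ ^ 2 * M ^ 2) * ‖W t ω‖ ^ 2 := by
        simp only [hv, norm_smul, mul_pow, Real.norm_eq_abs, sq_abs]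
        ring
      rw [e1]
      gcongr
      rw [le_div_iff₀ (by positivity)]
      calc 2 * l (t + 1) ^ 2 * (γ ^ 2 * M ^ 2) * (V * T)
          ≤ 2 * (2 / V) ^ 2 * (γ ^ 2 * M ^ 2) * (V * T) := by gcongr
        _ = 8 * (γ ^ 2 * M ^ 2 * T) / V := by field_simp; ring
        _ ≤ 8 * (V / 64) / V := by gcongr
        _ ≤ 1 := by field_simp; norm_num
    have h6 : inner ℝ (z t ω) (v t ω) = l (t + 1) * (2 * γ * inner ℝ (z t ω) (W t ω)) := by
      simp only [hv, inner_smul_right]; ring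
    have h7 := mul_le_mul_of_nonneg_left h3 hl0
    simp only [hX]
    rw [h2, h6]
    push_cast
    have h8 : 8 * ((t : ℝ) + 1) * (γ ^ 2 * M ^ 2) / V
        = 8 * t * (γ ^ 2 * M ^ 2) / V + 8 * (γ ^ 2 * M ^ 2) / V := by ring
    rw [h8]
    linarith

/-- Both noise martingales are controlled, up to time `T`, with probability at least `1 - β`. -/
theorem CondSubgaussian.measure_not_noise_le [IsProbabilityMeasure μ] {𝓕 : Filtration ℕ mΩ}
    {z u : ℕ → Ω → E} {M γ V β : ℝ} {T : ℕ} (hT : 0 < T) (hV : 0 < V) (hβ : 0 < β)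
    (hz : CondSubgaussian μ 𝓕 z M) (hzm : ∀ t, Measurable[𝓕 (t + 1)] (z t))
    (hzM : ∀ t ω, ‖z t ω‖ ≤ 2 * M) (hu : ∀ t, Measurable[𝓕 t] (u t))
    (hG : γ ^ 2 * M ^ 2 * T ≤ V / 64) :
    μ {ω | ¬ ((∀ D, (∀ s ≤ T, ‖u s ω‖ ≤ D) → ∀ t ≤ T,
        |∑ s ∈ Finset.range t, 2 * γ * inner ℝ (z s ω) (u s ω)|
          ≤ D ^ 2 / 32 + V * Real.log (3 / β)) ∧
      ∀ t ≤ T, ‖∑ s ∈ Finset.range t, γ • z s ω‖ ^ 2 ≤ V * (Real.log (3 / β) + 1 / 8))}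
      ≤ ENNReal.ofReal β := by
  have hβ3 : 0 < β / 3 := by positivity
  have h1 := hz.measure_sum_inner hV hβ3 hzm hu hG (ε := 1) (by norm_num)
  have h2 := hz.measure_sum_inner hV hβ3 hzm hu hG (ε := -1) (by norm_num)
  have h3 := hz.measure_norm_sum hT hV hβ3 hzm hzM hG
  rw [one_div_div] at h1 h2 h3
  refine (measure_mono ?_).trans ((measure_union_le _ _).trans
    (add_le_add ((measure_union_le _ _).trans (add_le_add h1 h2)) h3) |>.trans_eq ?_)
  · intro ω hω
    rw [Set.mem_ofPred_eq, not_and_or] at hω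
    rcases hω with hω | hω
    · push Not at hω
      obtain ⟨D, hD, t, ht, h⟩ := hω
      refine Or.inl ?_
      rcases lt_abs.1 h with h | h
      · exact Or.inl ⟨D, hD, t, ht, by linarith⟩
      · exact Or.inr ⟨D, hD, t, ht, by linarith⟩
    · push Not at hω
      obtain ⟨t, ht, h⟩ := hω
      exact Or.inr ⟨t, ht, h.le⟩
  · rw [← ENNReal.ofReal_add (by positivity) (by positivity),
      ← ENNReal.ofReal_add (by positivity) (by positivity)]
    congr 1
    ring

end Concentration

/-! ### Sub-Gaussian variables from square-exponential moments -/

section SquareExponential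

open scoped NNReal

theorem exp_le_add_exp_sq (y : ℝ) : Real.exp y ≤ y + Real.exp (y ^ 2) := by
  have h := Real.add_one_le_exp (y ^ 2)
  rcases le_total |y| 1 with hy | hy
  · have := abs_le.1 (Real.abs_exp_sub_one_sub_id_le hy)
    linarith [this.2]
  · rcases le_abs.1 hy with hy | hy
    · have : Real.exp y ≤ Real.exp (y ^ 2) := Real.exp_le_exp.2 (by nlinarith)
      linarith
    · have : Real.exp y ≤ 1 := Real.exp_le_one_iff.2 (by linarith)
      nlinarith

/-- The concave function `z ↦ z ^ s` lies below its tangent at `z = e`, here for `z = exp w`; on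
integration this replaces Jensen's inequality. -/
theorem exp_mul_le_of_le_one {s w : ℝ} (hs : 0 ≤ s) (hs1 : s ≤ 1) :
    Real.exp (s * w) ≤ Real.exp s * (1 - s + s * (Real.exp (-1) * Real.exp w)) := by
  have h := convexOn_exp.2 (Set.mem_univ 0) (Set.mem_univ (w - 1)) (sub_nonneg.2 hs1) hs
    (by ring)
  simp only [smul_eq_mul, mul_zero, zero_add, Real.exp_zero, mul_one] at h
  calc Real.exp (s * w) = Real.exp s * Real.exp (s * (w - 1)) := by rw [← Real.exp_add]; ring_nf
    _ ≤ _ := by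
      rw [show w - 1 = -1 + w by ring, Real.exp_add (-1)] at h
      rw [show w - 1 = -1 + w by ring]
      gcongr

variable {α : Type*} [MeasurableSpace α] {ν : Measure α} [IsProbabilityMeasure ν]

/-- A centred random variable with `E exp (X² / τ) ≤ e` has `E exp (t X) ≤ exp (τ t²)`. -/
theorem hasSubgaussianMGF_of_lintegral_exp_sq_le {X : α → ℝ} {τ : ℝ≥0} (hτ : 0 < τ)
    (hX : Integrable X ν) (hXm : Measurable X) (hX0 : ∫ a, X a ∂ν = 0)
    (h : ∫⁻ a, ENNReal.ofReal (Real.exp (X a ^ 2 / τ)) ∂ν ≤ ENNReal.ofReal (Real.exp 1)) :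
    HasSubgaussianMGF X (2 * τ) ν := by
  have hτ' : (0 : ℝ) < τ := hτ
  have hm : Measurable fun a => Real.exp (X a ^ 2 / τ) :=
    Real.measurable_exp.comp ((hXm.pow_const 2).div_const _)
  have hi : Integrable (fun a => Real.exp (X a ^ 2 / τ)) ν := by
    refine ⟨hm.aestronglyMeasurable, ?_⟩
    rw [hasFiniteIntegral_iff_ofReal (ae_of_all _ fun _ => (Real.exp_nonneg _))]
    exact h.trans_lt ENNReal.ofReal_lt_top
  have hI : ∫ a, Real.exp (X a ^ 2 / τ) ∂ν ≤ Real.exp 1 := by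
    rw [← ofReal_integral_eq_lintegral_ofReal hi (ae_of_all _ fun _ => (Real.exp_nonneg _))] at h
    exact (ENNReal.ofReal_le_ofReal_iff (Real.exp_nonneg _)).1 h
  -- the expectation of `exp (s X² / τ)` is at most `exp s` for `s ≤ 1`
  have hs : ∀ s : ℝ, 0 ≤ s → s ≤ 1 →
      Integrable (fun a => Real.exp (s * (X a ^ 2 / τ))) ν ∧
      ∫ a, Real.exp (s * (X a ^ 2 / τ)) ∂ν ≤ Real.exp s := by
    intro s h0 h1
    have hi' : Integrable (fun a => Real.exp s *
        (1 - s + s * (Real.exp (-1) * Real.exp (X a ^ 2 / τ)))) ν :=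
      ((integrable_const (1 - s)).add ((hi.const_mul _).const_mul s)).const_mul _
    have hint : Integrable (fun a => Real.exp (s * (X a ^ 2 / τ))) ν := by
      refine hi'.mono' ?_ (ae_of_all _ fun a => ?_)
      · exact (Real.measurable_exp.comp
          (((hXm.pow_const 2).div_const _).const_mul s)).aestronglyMeasurable
      · rw [Real.norm_of_nonneg (Real.exp_nonneg _)]
        exact exp_mul_le_of_le_one h0 h1
    refine ⟨hint, (integral_mono hint hi' fun a => exp_mul_le_of_le_one h0 h1).trans ?_⟩
    rw [integral_const_mul, integral_add (integrable_const _)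
      ((hi.const_mul _).const_mul _), integral_const_mul, integral_const_mul]
    have : Real.exp (-1) * ∫ a, Real.exp (X a ^ 2 / τ) ∂ν ≤ 1 := by
      calc _ ≤ Real.exp (-1) * Real.exp 1 := by gcongr
        _ = 1 := by rw [← Real.exp_add]; simp
    have h3 : s * (Real.exp (-1) * ∫ a, Real.exp (X a ^ 2 / τ) ∂ν) ≤ s * 1 := by gcongr
    have : 1 - s + s * (Real.exp (-1) * ∫ a, Real.exp (X a ^ 2 / τ) ∂ν) ≤ 1 := by linarith
    simpa using mul_le_mul_of_nonneg_left this (Real.exp_nonneg s)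
  have hexpm : ∀ t : ℝ, AEStronglyMeasurable (fun a => Real.exp (t * X a)) ν := fun t =>
    (Real.measurable_exp.comp (hXm.const_mul t)).aestronglyMeasurable
  have main : ∀ t : ℝ, Integrable (fun a => Real.exp (t * X a)) ν ∧
      ∫ a, Real.exp (t * X a) ∂ν ≤ Real.exp (t ^ 2 * τ) := by
    intro t
    rcases le_total (t ^ 2 * τ) 1 with ht | ht
    · obtain ⟨h1, h2⟩ := hs (t ^ 2 * τ) (by positivity) ht
      have e : ∀ a, t ^ 2 * τ * (X a ^ 2 / τ) = (t * X a) ^ 2 := fun a => by field_simp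
      simp only [e] at h1 h2
      have hb : Integrable (fun a => t * X a + Real.exp ((t * X a) ^ 2)) ν :=
        (hX.const_mul t).add h1
      have hint : Integrable (fun a => Real.exp (t * X a)) ν := by
        refine hb.mono' (hexpm t) (ae_of_all _ fun a => ?_)
        rw [Real.norm_of_nonneg (Real.exp_nonneg _)]
        exact exp_le_add_exp_sq _
      refine ⟨hint, (integral_mono hint hb fun a => exp_le_add_exp_sq _).trans ?_⟩
      rw [integral_add (hX.const_mul t) h1, integral_const_mul, hX0]
      simpa using h2
    · obtain ⟨h1, h2⟩ := hs (1 / 2) (by norm_num) (by norm_num)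
      have e : ∀ a, Real.exp (t * X a)
          ≤ Real.exp (t ^ 2 * τ / 2) * Real.exp (1 / 2 * (X a ^ 2 / τ)) := by
        intro a
        rw [← Real.exp_add]
        refine Real.exp_le_exp.2 ?_
        have : t ^ 2 * τ / 2 + 1 / 2 * (X a ^ 2 / τ) - t * X a
            = (t * τ - X a) ^ 2 / (2 * τ) := by field_simp; ring
        have : 0 ≤ (t * τ - X a) ^ 2 / (2 * τ) := by positivity
        linarith
      have hb := h1.const_mul (Real.exp (t ^ 2 * τ / 2))
      have hint : Integrable (fun a => Real.exp (t * X a)) ν := by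
        refine hb.mono' (hexpm t) (ae_of_all _ fun a => ?_)
        rw [Real.norm_of_nonneg (Real.exp_nonneg _)]
        exact e a
      refine ⟨hint, (integral_mono hint hb e).trans ?_⟩
      rw [integral_const_mul]
      calc _ ≤ Real.exp (t ^ 2 * τ / 2) * Real.exp (1 / 2) := by gcongr
        _ = Real.exp (t ^ 2 * τ / 2 + 1 / 2) := by rw [Real.exp_add]
        _ ≤ _ := Real.exp_le_exp.2 (by linarith)
  refine ⟨fun t => (main t).1, fun t => ?_⟩
  refine (main t).2.trans_eq ?_
  congr 1
  push_cast
  ring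

/-- Two-sided tail bound for the average of independent sub-Gaussian variables. -/
theorem measureReal_abs_average_gt_le {n : ℕ} (hn : 0 < n) {X : Fin n → α → ℝ}
    (hind : iIndepFun X ν) {τ : ℝ≥0} (hX : ∀ i, HasSubgaussianMGF (X i) (2 * τ) ν) {ε : ℝ}
    (hε : 0 ≤ ε) :
    ν.real {a | ε < |(1 / (n : ℝ)) * ∑ i, X i a|} ≤ 2 * Real.exp (-(n * ε ^ 2 / (4 * τ))) := by
  have hn' : (0 : ℝ) < n := by exact_mod_cast hn
  have h1 := HasSubgaussianMGF.sum_of_iIndepFun hind (s := Finset.univ) fun i _ => hX i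
  have e : -(n * ε) ^ 2 / (2 * ((∑ _i : Fin n, 2 * τ : ℝ≥0) : ℝ)) = -(n * ε ^ 2 / (4 * τ)) := by
    simp only [Finset.sum_const, Finset.card_univ, Fintype.card_fin]
    push_cast
    rcases eq_or_ne (τ : ℝ) 0 with h | h
    · simp [h]
    · field_simp
      ring
  have h2 := h1.measure_ge_le (ε := n * ε) (by positivity)
  have h3 := h1.neg.measure_ge_le (ε := n * ε) (by positivity)
  rw [e] at h2 h3
  rw [two_mul]
  refine le_trans (measureReal_mono ?_) ((measureReal_union_le _ _).trans (add_le_add h2 h3))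
  intro a ha
  have ha' : ε < |(1 / (n : ℝ)) * ∑ i, X i a| := ha
  rw [one_div, inv_mul_eq_div] at ha'
  rcases lt_abs.1 ha' with h | h
  · left
    rw [lt_div_iff₀ hn'] at h
    simp only [Set.mem_ofPred_eq]
    linarith
  · right
    rw [← neg_div, lt_div_iff₀ hn'] at h
    simp only [Set.mem_ofPred_eq, Pi.neg_apply]
    linarith

end SquareExponential

/-! ### Independence of the samples and measurability of the algorithm -/

section Samples

open scoped ENNReal

universe u v

/-- If `s` is independent of `m`, a bound on `E φ (a, s)` for every fixed `a` carries over to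
random `m`-measurable `a`, also after weighting with an `m`-measurable `ρ`. -/
theorem lintegral_mul_le_of_indep {Ω : Type*} {m mΩ : MeasurableSpace Ω} {μ : Measure Ω}
    [IsProbabilityMeasure μ] (hm : m ≤ mΩ) {S H : Type*} [MeasurableSpace S] [MeasurableSpace H]
    {s : Ω → S} (hs : Measurable s) (hind : Indep m (MeasurableSpace.comap s inferInstance) μ)
    {h : Ω → H} (hh : Measurable[m] h) {φ : H × S → ℝ≥0∞} (hφ : Measurable φ) {K : ℝ≥0∞}
    (hK : ∀ a, ∫⁻ ω, φ (a, s ω) ∂μ ≤ K) {ρ : Ω → ℝ≥0∞} (hρ : Measurable[m] ρ) :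
    ∫⁻ ω, ρ ω * φ (h ω, s ω) ∂μ ≤ (∫⁻ ω, ρ ω ∂μ) * K := by
  have hρ' : Measurable ρ := hρ.mono hm le_rfl
  have hh' : Measurable h := hh.mono hm le_rfl
  have hindf : IndepFun (fun ω => (ρ ω, h ω)) s μ := by
    rw [IndepFun_iff_Indep]
    exact indep_of_indep_of_le_left hind (hρ.prodMk hh).comap_le
  have hmap := hindf.map_prod_eq_prod_map_map (hρ'.prodMk hh').aemeasurable hs.aemeasurable
  have := Measure.isProbabilityMeasure_map (μ := μ) hs.aemeasurable
  have hψ : Measurable fun p : (ℝ≥0∞ × H) × S => p.1.1 * φ (p.1.2, p.2) := by fun_prop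
  calc ∫⁻ ω, ρ ω * φ (h ω, s ω) ∂μ
      = ∫⁻ p, p.1.1 * φ (p.1.2, p.2) ∂(μ.map fun ω => ((ρ ω, h ω), s ω)) := by
        rw [lintegral_map hψ ((hρ'.prodMk hh').prodMk hs)]
    _ = ∫⁻ q, ∫⁻ x, q.1 * φ (q.2, x) ∂(μ.map s) ∂(μ.map fun ω => (ρ ω, h ω)) := by
        rw [hmap, lintegral_prod _ hψ.aemeasurable]
    _ ≤ ∫⁻ q, q.1 * K ∂(μ.map fun ω => (ρ ω, h ω)) := by
        refine lintegral_mono fun q => ?_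
        rw [lintegral_const_mul _ (by fun_prop), lintegral_map (by fun_prop) hs]
        gcongr
        exact hK _
    _ = (∫⁻ ω, ρ ω ∂μ) * K := by
        rw [lintegral_map (by fun_prop) (hρ'.prodMk hh'), lintegral_mul_const _ hρ']

namespace Problem

variable {n d : ℕ} {Ξ : Fin n → Type u} {Z : Fin n → Type v}
  [∀ i, MeasurableSpace (Ξ i)] [∀ i, MeasurableSpace (Z i)]
  {P : Problem n d Ξ Z} {C : Fin n → Vec d → Vec d} {γ c M τ : ℝ} {x₀ : Vec d}
  {Ω : Type*} {mΩ : MeasurableSpace Ω} {μ : Measure Ω}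
  {ξ : ℕ → ∀ i, Ω → Ξ i} {ζ : ℕ → ∀ i, Ω → Z i}

/-- The σ-algebra generated by a single sample: by `ξ t i` for the index `((t, i), true)` and by
`ζ t i` for the index `((t, i), false)`. -/
@[reducible]
def sampleSigma (ξ : ℕ → ∀ i, Ω → Ξ i) (ζ : ℕ → ∀ i, Ω → Z i)
    (q : Σ _ : ℕ × Fin n, Bool) : MeasurableSpace Ω :=
  match q with
  | ⟨(t, i), true⟩ => MeasurableSpace.comap (ξ t i) inferInstance
  | ⟨(t, i), false⟩ => MeasurableSpace.comap (ζ t i) inferInstance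

theorem sampleSigma_le (hξ : ∀ t i, Measurable (ξ t i)) (hζ : ∀ t i, Measurable (ζ t i))
    (q : Σ _ : ℕ × Fin n, Bool) : sampleSigma ξ ζ q ≤ mΩ := by
  obtain ⟨⟨t, i⟩, _ | _⟩ := q
  · exact (hζ t i).comap_le
  · exact (hξ t i).comap_le

/-- All single samples are mutually independent: independence of the pairs and independence within
each pair combine. -/
theorem IndepSamples.iIndep_sampleSigma [IsProbabilityMeasure μ] (h : P.IndepSamples μ ξ ζ) :
    iIndep (sampleSigma ξ ζ) μ := by
  have hle := sampleSigma_le (fun t i => (h.law_ξ t i).measurable)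
    (fun t i => (h.law_ζ t i).measurable)
  have key := iIndepFun_uncurry (P := μ) (ι := ℕ × Fin n) (κ := fun _ => Bool)
    (𝓧 := fun _ _ => Ω) (m𝓧 := fun p b => sampleSigma ξ ζ ⟨p, b⟩) (X := fun _ _ => id)
    (fun p b => measurable_id.mono (hle ⟨p, b⟩) le_rfl) ?_ ?_
  · rw [iIndepFun_iff_iIndep] at key
    simpa only [MeasurableSpace.comap_id] using key
  · have h1 := h.indep_pairs
    rw [iIndepFun_iff_iIndep] at h1 ⊢
    convert h1 using 2 with p
    obtain ⟨t, i⟩ := p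
    refine MeasurableSpace.comap_iSup.trans ?_
    rw [iSup_bool_eq, MeasurableSpace.comap_comp, MeasurableSpace.comap_comp]
    simp only [Prod.instMeasurableSpace, MeasurableSpace.prod, MeasurableSpace.comap_sup,
      MeasurableSpace.comap_comp]
    rfl
  · rintro ⟨t, i⟩
    have h2 := h.indep_within t i
    rw [IndepFun_iff_Indep] at h2
    rw [iIndepFun_iff_iIndep, iIndep_iff]
    intro s f hf
    have hs : s = ∅ ∨ s = {true} ∨ s = {false} ∨ s = {true, false} := by
      clear hf
      revert s
      decide
    rcases hs with rfl | rfl | rfl | rfl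
    · simp
    · simp
    · simp
    · have h3 := MeasurableSpace.comap_id.le _ (hf true (by simp))
      have h4 := MeasurableSpace.comap_id.le _ (hf false (by simp))
      rw [Finset.set_biInter_insert, Finset.set_biInter_singleton, Finset.prod_pair (by simp)]
      exact (Indep_iff _ _ _).1 h2 _ _ h3 h4

/-- The σ-algebras of the samples drawn before iteration `t`. -/
def history (hξ : ∀ t i, Measurable (ξ t i)) (hζ : ∀ t i, Measurable (ζ t i)) :
    Filtration ℕ mΩ where
  seq t := ⨆ q ∈ {q : Σ _ : ℕ × Fin n, Bool | q.1.1 < t}, sampleSigma ξ ζ q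
  mono' _ _ hst := biSup_mono fun _ hq => lt_of_lt_of_le hq hst
  le' _ := iSup₂_le fun q _ => sampleSigma_le hξ hζ q

theorem measurable_ξ_iSup {Q : Set (Σ _ : ℕ × Fin n, Bool)} {t : ℕ}
    (hQ : ∀ i, ⟨(t, i), true⟩ ∈ Q) :
    Measurable[⨆ q ∈ Q, sampleSigma ξ ζ q] fun ω i => ξ t i ω := by
  refine @measurable_pi_lambda _ _ _ (⨆ q ∈ Q, sampleSigma ξ ζ q) _ _ fun i => ?_
  exact (comap_measurable (ξ t i)).mono (le_iSup₂ (f := fun q _ => sampleSigma ξ ζ q) _ (hQ i))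
    le_rfl

theorem measurable_ζ_iSup {Q : Set (Σ _ : ℕ × Fin n, Bool)} {t : ℕ}
    (hQ : ∀ i, ⟨(t, i), false⟩ ∈ Q) :
    Measurable[⨆ q ∈ Q, sampleSigma ξ ζ q] fun ω i => ζ t i ω := by
  refine @measurable_pi_lambda _ _ _ (⨆ q ∈ Q, sampleSigma ξ ζ q) _ _ fun i => ?_
  exact (comap_measurable (ζ t i)).mono (le_iSup₂ (f := fun q _ => sampleSigma ξ ζ q) _ (hQ i))
    le_rfl

theorem SubGaussianEval.measurable_estG (hP : P.SubGaussianEval τ) :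
    Measurable fun p : Vec d × (∀ i, Z i) => P.estG p.1 p.2 := by
  refine (Finset.measurable_fun_sum _ fun i _ => ?_).const_mul _
  exact (hP.measurable_evalG i).comp
    (measurable_fst.prodMk ((measurable_pi_apply i).comp measurable_snd))

theorem measurable_workerSubgrad (hP : P.StochConvex) (hE : P.SubGaussianEval τ) (i : Fin n) :
    Measurable fun p : Vec d × (∀ i, Ξ i) × (∀ i, Z i) =>
      P.workerSubgrad c p.1 p.2.1 p.2.2 i := by
  refine Measurable.ite ?_ ?_ ?_
  · have : Measurable fun p : Vec d × (∀ i, Ξ i) × (∀ i, Z i) => P.estG p.1 p.2.2 :=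
      hE.measurable_estG.comp (measurable_fst.prodMk measurable_snd.snd)
    exact this measurableSet_Iic
  · exact (hP.measurable_F' i).comp
      (measurable_fst.prodMk ((measurable_pi_apply i).comp measurable_snd.fst))
  · exact (hP.measurable_G' i).comp
      (measurable_fst.prodMk ((measurable_pi_apply i).comp measurable_snd.fst))

theorem measurable_avgSubgrad (hP : P.StochConvex) (hE : P.SubGaussianEval τ) :
    Measurable fun p : Vec d × (∀ i, Ξ i) × (∀ i, Z i) => P.avgSubgrad c p.1 p.2.1 p.2.2 :=
  (Finset.measurable_fun_sum _ fun i _ => measurable_workerSubgrad hP hE i).fun_const_smul _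

/-- One iteration of the algorithm is a measurable function of the state and the samples. -/
theorem measurable_step (hP : P.StochConvex) (hE : P.SubGaussianEval τ)
    (hC : ∀ i, Measurable (C i)) :
    Measurable fun p : (Vec d × (Fin n → Vec d)) × (∀ i, Ξ i) × (∀ i, Z i) =>
      (p.1.1 - γ • ((1 / (n : ℝ)) • ∑ i, C i (p.1.2 i + P.workerSubgrad c p.1.1 p.2.1 p.2.2 i)),
        fun i => p.1.2 i + P.workerSubgrad c p.1.1 p.2.1 p.2.2 i
          - C i (p.1.2 i + P.workerSubgrad c p.1.1 p.2.1 p.2.2 i)) := by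
  have hw : ∀ i, Measurable fun p : (Vec d × (Fin n → Vec d)) × (∀ i, Ξ i) × (∀ i, Z i) =>
      P.workerSubgrad c p.1.1 p.2.1 p.2.2 i := fun i =>
    (measurable_workerSubgrad hP hE i).comp (measurable_fst.fst.prodMk measurable_snd)
  have ha : ∀ i, Measurable fun p : (Vec d × (Fin n → Vec d)) × (∀ i, Ξ i) × (∀ i, Z i) =>
      p.1.2 i + P.workerSubgrad c p.1.1 p.2.1 p.2.2 i := fun i =>
    ((measurable_pi_apply i).comp measurable_fst.snd).add (hw i)
  have hv := fun i => (hC i).comp (ha i)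
  have hs := Finset.measurable_fun_sum Finset.univ fun i _ => hv i
  refine Measurable.prodMk ?_ (measurable_pi_lambda _ fun i => (ha i).sub (hv i))
  exact measurable_fst.fst.sub ((hs.fun_const_smul _).fun_const_smul _)

theorem measurable_state (hP : P.StochConvex) (hE : P.SubGaussianEval τ)
    (hC : ∀ i, Measurable (C i)) (hξ : ∀ t i, Measurable (ξ t i))
    (hζ : ∀ t i, Measurable (ζ t i)) (t : ℕ) :
    Measurable[history hξ hζ t] fun ω =>
      P.state C γ c x₀ (fun t i => ξ t i ω) (fun t i => ζ t i ω) t := by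
  induction t with
  | zero => exact measurable_const
  | succ t ih =>
    have h1 := ih.mono ((history hξ hζ).mono t.le_succ) le_rfl
    have h2 : Measurable[history hξ hζ (t + 1)] fun ω i => ξ t i ω :=
      measurable_ξ_iSup fun i => t.lt_succ_self
    have h3 : Measurable[history hξ hζ (t + 1)] fun ω i => ζ t i ω :=
      measurable_ζ_iSup fun i => t.lt_succ_self
    exact (measurable_step (γ := γ) (c := c) hP hE hC).comp (h1.prodMk (h2.prodMk h3))

end Problem

end Samples

/-! ### Oracles: mean subgradients, subgradient noise, constraint evaluations -/

section Oracles

open scoped ENNReal NNReal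

universe u v

theorem integral_sub_le_inner_of_isSubgradient {d : ℕ} {S : Type*} [MeasurableSpace S]
    {ν : Measure S} {Φ : Vec d → S → ℝ} (hΦ : ∀ x, Integrable (Φ x) ν) {w : S → Vec d}
    (hw : Integrable w ν) {x : Vec d} (hs : ∀ s, IsSubgradient (fun y => Φ y s) x (w s))
    (y : Vec d) : ∫ s, Φ x s ∂ν - ∫ s, Φ y s ∂ν ≤ inner ℝ (∫ s, w s ∂ν) (x - y) := by
  rw [← integral_sub (hΦ x) (hΦ y), real_inner_comm, ← integral_inner hw]
  refine integral_mono ((hΦ x).sub (hΦ y)) (hw.const_inner _) fun s => ?_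
  have h := hs s y
  rw [← neg_sub x y, inner_neg_right, real_inner_comm] at h
  dsimp only
  linarith

theorem convexOn_integral {d : ℕ} {S : Type*} [MeasurableSpace S] {ν : Measure S}
    {Φ : Vec d → S → ℝ} (hΦ : ∀ x, Integrable (Φ x) ν)
    (hc : ∀ s, ConvexOn ℝ Set.univ fun x => Φ x s) :
    ConvexOn ℝ Set.univ fun x => ∫ s, Φ x s ∂ν := by
  refine ⟨convex_univ, fun x _ y _ a b ha hb hab => ?_⟩
  simp only [smul_eq_mul]
  rw [← integral_const_mul, ← integral_const_mul,
    ← integral_add ((hΦ x).const_mul a) ((hΦ y).const_mul b)]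
  exact integral_mono (hΦ _) (((hΦ x).const_mul a).add ((hΦ y).const_mul b)) fun s =>
    (hc s).2 (Set.mem_univ x) (Set.mem_univ y) ha hb hab

theorem convexOn_average {d n : ℕ} {φ : Fin n → Vec d → ℝ}
    (h : ∀ i, ConvexOn ℝ Set.univ (φ i)) :
    ConvexOn ℝ Set.univ fun x => (1 / (n : ℝ)) * ∑ i, φ i x := by
  have h1 : ConvexOn ℝ Set.univ fun x => ∑ i, φ i x := by
    refine ⟨convex_univ, fun x hx y hy a b ha hb hab => ?_⟩
    simp only [smul_eq_mul, Finset.mul_sum, ← Finset.sum_add_distrib]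
    exact Finset.sum_le_sum fun i _ => (h i).2 hx hy ha hb hab
  exact h1.smul (by positivity)

namespace Problem

variable {n d : ℕ} {Ξ : Fin n → Type u} {Z : Fin n → Type v}
  [∀ i, MeasurableSpace (Ξ i)] [∀ i, MeasurableSpace (Z i)]
  {P : Problem n d Ξ Z} {C : Fin n → Vec d → Vec d} {γ c M τ : ℝ} {x₀ : Vec d}
  {Ω : Type*} {mΩ : MeasurableSpace Ω} {μ : Measure Ω}
  {ξ : ℕ → ∀ i, Ω → Ξ i} {ζ : ℕ → ∀ i, Ω → Z i}

theorem StochConvex.convexOn_f (hP : P.StochConvex) : ConvexOn ℝ Set.univ P.f :=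
  convexOn_average fun i => convexOn_integral (hP.integrable_F i) (hP.convex_F i)

theorem StochConvex.convexOn_g (hP : P.StochConvex) : ConvexOn ℝ Set.univ P.g :=
  convexOn_average fun i => convexOn_integral (hP.integrable_G i) (hP.convex_G i)

theorem StochConvex.integrable_F' (hP : P.StochConvex) (hM : 0 ≤ M)
    (hB : P.BoundedSubgradients M) (i : Fin n) (x : Vec d) :
    Integrable (P.F' i x) (P.distr i) := by
  have := hP.prob_distr i
  refine (integrable_const M).mono' ?_ (ae_of_all _ fun s => ?_)
  · exact ((hP.measurable_F' i).comp (measurable_const.prodMk measurable_id)).aestronglyMeasurable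
  · exact abs_le_of_sq_le_sq' (hB i x s).1 hM |>.2

theorem StochConvex.integrable_G' (hP : P.StochConvex) (hM : 0 ≤ M)
    (hB : P.BoundedSubgradients M) (i : Fin n) (x : Vec d) :
    Integrable (P.G' i x) (P.distr i) := by
  have := hP.prob_distr i
  refine (integrable_const M).mono' ?_ (ae_of_all _ fun s => ?_)
  · exact ((hP.measurable_G' i).comp (measurable_const.prodMk measurable_id)).aestronglyMeasurable
  · exact abs_le_of_sq_le_sq' (hB i x s).2 hM |>.2

/-- The conditional mean of `avgSubgrad c x ξ ζ` given the evaluation samples `ζ`. -/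
noncomputable def meanSubgrad (P : Problem n d Ξ Z) (c : ℝ) (x : Vec d) (ζ : ∀ i, Z i) : Vec d :=
  if P.estG x ζ ≤ c then (1 / (n : ℝ)) • ∑ i, ∫ s, P.F' i x s ∂(P.distr i)
  else (1 / (n : ℝ)) • ∑ i, ∫ s, P.G' i x s ∂(P.distr i)

theorem norm_meanSubgrad_le (hn : 0 < n) (hM : 0 ≤ M) (hP : P.StochConvex)
    (hB : P.BoundedSubgradients M) (x : Vec d) (ζ : ∀ i, Z i) : ‖P.meanSubgrad c x ζ‖ ≤ M := by
  have := hP.prob_distr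
  unfold meanSubgrad
  split_ifs
  · refine norm_average_le hn fun i => ?_
    refine (norm_integral_le_of_norm_le_const (C := M) (ae_of_all _ fun s => ?_)).trans (by simp)
    exact abs_le_of_sq_le_sq' (hB i x s).1 hM |>.2
  · refine norm_average_le hn fun i => ?_
    refine (norm_integral_le_of_norm_le_const (C := M) (ae_of_all _ fun s => ?_)).trans (by simp)
    exact abs_le_of_sq_le_sq' (hB i x s).2 hM |>.2

theorem f_sub_le_inner (hM : 0 ≤ M) (hP : P.StochConvex) (hB : P.BoundedSubgradients M)
    {x : Vec d} {ζ : ∀ i, Z i} (h : P.estG x ζ ≤ c) (y : Vec d) :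
    P.f x - P.f y ≤ inner ℝ (P.meanSubgrad c x ζ) (x - y) := by
  rw [meanSubgrad, if_pos h, real_inner_smul_left, sum_inner, f, f, ← mul_sub,
    ← Finset.sum_sub_distrib]
  gcongr with i
  exact integral_sub_le_inner_of_isSubgradient (hP.integrable_F i) (hP.integrable_F' hM hB i x)
    (hP.subgradient_F' i x) y

theorem g_sub_le_inner (hM : 0 ≤ M) (hP : P.StochConvex) (hB : P.BoundedSubgradients M)
    {x : Vec d} {ζ : ∀ i, Z i} (h : ¬ P.estG x ζ ≤ c) (y : Vec d) :
    P.g x - P.g y ≤ inner ℝ (P.meanSubgrad c x ζ) (x - y) := by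
  rw [meanSubgrad, if_neg h, real_inner_smul_left, sum_inner, g, g, ← mul_sub,
    ← Finset.sum_sub_distrib]
  gcongr with i
  exact integral_sub_le_inner_of_isSubgradient (hP.integrable_G i) (hP.integrable_G' hM hB i x)
    (hP.subgradient_G' i x) y

theorem measurable_meanSubgrad (hP : P.StochConvex) (hE : P.SubGaussianEval τ) :
    Measurable fun p : Vec d × (∀ i, Z i) => P.meanSubgrad c p.1 p.2 := by
  have := hP.prob_distr
  refine Measurable.ite (hE.measurable_estG measurableSet_Iic) ?_ ?_
  · refine (Finset.measurable_fun_sum _ fun i _ => ?_).fun_const_smul _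
    exact (hP.measurable_F' i).stronglyMeasurable.integral_prod_right'.measurable.comp
      measurable_fst
  · refine (Finset.measurable_fun_sum _ fun i _ => ?_).fun_const_smul _
    exact (hP.measurable_G' i).stronglyMeasurable.integral_prod_right'.measurable.comp
      measurable_fst

/-- Measurability comes from the unbiased evaluations. -/
theorem measurable_g (hE : P.SubGaussianEval τ) : Measurable P.g := by
  have := hE.prob_evalDistr
  refine (Finset.measurable_fun_sum _ fun i _ => ?_).const_mul _
  have : P.gi i = fun x => ∫ z, P.evalG i x z ∂(P.evalDistr i) :=
    funext fun x => (hE.unbiased i x).symm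
  rw [this]
  exact (hE.measurable_evalG i).stronglyMeasurable.integral_prod_right'.measurable

theorem integral_inner_avgSubgrad (hM : 0 ≤ M) (hP : P.StochConvex)
    (hB : P.BoundedSubgradients M) (h : P.IndepSamples μ ξ ζ) (t : ℕ) (x w : Vec d)
    (r : ∀ i, Z i) :
    ∫ ω, inner ℝ w (P.avgSubgrad c x (fun i => ξ t i ω) r) ∂μ
      = inner ℝ w (P.meanSubgrad c x r) := by
  have key : ∀ Φ : ∀ i, Ξ i → Vec d, (∀ i, Integrable (Φ i) (P.distr i)) →
      ∫ ω, inner ℝ w ((1 / (n : ℝ)) • ∑ i, Φ i (ξ t i ω)) ∂μ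
        = inner ℝ w ((1 / (n : ℝ)) • ∑ i, ∫ s, Φ i s ∂(P.distr i)) := by
    intro Φ hΦ
    have hi : ∀ i, Integrable (fun ω => Φ i (ξ t i ω)) μ := fun i =>
      (h.law_ξ t i).integrable_comp_of_integrable (hΦ i)
    have hs : Integrable (fun ω => (1 / (n : ℝ)) • ∑ i, Φ i (ξ t i ω)) μ :=
      (integrable_finsetSum _ fun i _ => hi i).fun_smul _
    rw [integral_inner hs, integral_smul, integral_finsetSum _ fun i _ => hi i]
    congr! with i
    rw [← (h.law_ξ t i).map_eq, integral_map (h.law_ξ t i).measurable.aemeasurable]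
    rw [(h.law_ξ t i).map_eq]
    exact (hΦ i).aestronglyMeasurable
  unfold avgSubgrad workerSubgrad meanSubgrad
  split_ifs
  · exact key _ fun i => hP.integrable_F' hM hB i x
  · exact key _ fun i => hP.integrable_G' hM hB i x

/-- Hoeffding's lemma for the subgradient noise at a fixed point. -/
theorem lintegral_exp_noise_le [IsProbabilityMeasure μ] (hn : 0 < n) (hM : 0 ≤ M)
    (hP : P.StochConvex) (hE : P.SubGaussianEval τ)
    (hB : P.BoundedSubgradients M) (h : P.IndepSamples μ ξ ζ) (t : ℕ) (x w : Vec d)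
    (r : ∀ i, Z i) :
    ∫⁻ ω, ENNReal.ofReal (Real.exp (inner ℝ
      (P.avgSubgrad c x (fun i => ξ t i ω) r - P.meanSubgrad c x r) w
        - M ^ 2 * ‖w‖ ^ 2 / 2)) ∂μ ≤ 1 := by
  set X : Ω → ℝ := fun ω => inner ℝ w (P.avgSubgrad c x (fun i => ξ t i ω) r) with hX
  have hm : Measurable X := by
    have h1 : Measurable fun ω i => ξ t i ω :=
      measurable_pi_lambda _ fun i => (h.law_ξ t i).measurable
    exact ((measurable_avgSubgrad hP hE).comp
      (measurable_const.prodMk (h1.prodMk measurable_const))).const_inner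
  have hb : ∀ ω, X ω ∈ Set.Icc (-(M * ‖w‖)) (M * ‖w‖) := by
    intro ω
    rw [Set.mem_Icc, ← abs_le]
    refine (abs_real_inner_le_norm _ _).trans ?_
    rw [mul_comm]
    gcongr
    exact hB.norm_avgSubgrad_le hn hM _ _ _
  have hsub := hasSubgaussianMGF_of_mem_Icc hm.aemeasurable (ae_of_all μ hb)
  have hmean : ∫ ω, X ω ∂μ = inner ℝ w (P.meanSubgrad c x r) :=
    integral_inner_avgSubgrad hM hP hB h t x w r
  have e : ∀ ω, inner ℝ (P.avgSubgrad c x (fun i => ξ t i ω) r - P.meanSubgrad c x r) w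
      - M ^ 2 * ‖w‖ ^ 2 / 2 = 1 * (X ω - ∫ ω, X ω ∂μ) + -(M ^ 2 * ‖w‖ ^ 2 / 2) := by
    intro ω
    rw [hmean, hX, real_inner_comm, inner_sub_right]
    ring
  have hint := hsub.integrable_exp_mul 1
  have hmgf := hsub.mgf_le 1
  simp only [e, Real.exp_add]
  rw [← ofReal_integral_eq_lintegral_ofReal (hint.mul_const _) (ae_of_all _ fun ω => by positivity),
    integral_mul_const, ← ENNReal.ofReal_one]
  refine ENNReal.ofReal_le_ofReal ?_
  have hpar : (((‖M * ‖w‖ - -(M * ‖w‖)‖₊ / 2) ^ 2 : ℝ≥0) : ℝ) * 1 ^ 2 / 2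
      = M ^ 2 * ‖w‖ ^ 2 / 2 := by
    push_cast
    rw [Real.norm_of_nonneg (by nlinarith [mul_nonneg hM (norm_nonneg w)])]
    ring
  rw [hpar] at hmgf
  calc _ ≤ Real.exp (M ^ 2 * ‖w‖ ^ 2 / 2) * Real.exp (-(M ^ 2 * ‖w‖ ^ 2 / 2)) := by
        gcongr
        exact hmgf
    _ = 1 := by rw [← Real.exp_add]; simp

theorem measurable_exp_noise (hP : P.StochConvex) (hE : P.SubGaussianEval τ) :
    Measurable fun p : (Vec d × (∀ i, Z i) × Vec d) × (∀ i, Ξ i) =>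
      ENNReal.ofReal (Real.exp (inner ℝ
        (P.avgSubgrad c p.1.1 p.2 p.1.2.1 - P.meanSubgrad c p.1.1 p.1.2.1) p.1.2.2
          - M ^ 2 * ‖p.1.2.2‖ ^ 2 / 2)) := by
  have g1 : Measurable fun p : (Vec d × (∀ i, Z i) × Vec d) × (∀ i, Ξ i) =>
      (p.1.1, p.2, p.1.2.1) := by fun_prop
  have g2 : Measurable fun p : (Vec d × (∀ i, Z i) × Vec d) × (∀ i, Ξ i) =>
      (p.1.1, p.1.2.1) := by fun_prop
  have h1 := (measurable_avgSubgrad (c := c) hP hE).comp g1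
  have h2 := (measurable_meanSubgrad (c := c) hP hE).comp g2
  have h3 : Measurable fun p : (Vec d × (∀ i, Z i) × Vec d) × (∀ i, Ξ i) => p.1.2.2 := by
    fun_prop
  exact (Real.measurable_exp.comp (((h1.sub h2).inner h3).sub
    (((h3.norm.pow_const 2).const_mul _).div_const 2))).ennreal_ofReal

/-- The subgradient noise is sub-Gaussian conditionally on the history.  The average of the
subgradients is bounded by `M`, and it is centred even given the evaluation samples of the same
iteration, which decide between objective and constraint. -/
theorem condSubgaussian_noise [IsProbabilityMeasure μ] (hn : 0 < n) (hM : 0 ≤ M)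
    (hP : P.StochConvex) (hE : P.SubGaussianEval τ)
    (hB : P.BoundedSubgradients M) (h : P.IndepSamples μ ξ ζ) (hC : ∀ i, Measurable (C i))
    (hξ : ∀ t i, Measurable (ξ t i)) (hζ : ∀ t i, Measurable (ζ t i)) :
    CondSubgaussian μ (history hξ hζ) (fun t ω =>
      P.avgSubgrad c (P.iterate C γ c x₀ (fun t i => ξ t i ω) (fun t i => ζ t i ω) t)
        (fun i => ξ t i ω) (fun i => ζ t i ω)
      - P.meanSubgrad c (P.iterate C γ c x₀ (fun t i => ξ t i ω) (fun t i => ζ t i ω) t)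
        (fun i => ζ t i ω)) M := by
  intro t ρ w hρ hw
  -- the past together with the evaluation samples of iteration `t`
  set Q : Set (Σ _ : ℕ × Fin n, Bool) := {q | q.1.1 < t ∨ q.1.1 = t ∧ q.2 = false} with hQ
  set Q' : Set (Σ _ : ℕ × Fin n, Bool) := {q | q.1.1 = t ∧ q.2 = true} with hQ'
  have hdisj : Disjoint Q Q' := by
    rw [Set.disjoint_left]
    rintro q (h1 | h1) h2
    · exact h1.ne h2.1
    · exact Bool.noConfusion (h1.2.symm.trans h2.2)
  have hle := sampleSigma_le hξ hζ
  have hind := indep_iSup_of_disjoint hle h.iIndep_sampleSigma hdisj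
  have hmono : history hξ hζ t ≤ ⨆ q ∈ Q, sampleSigma ξ ζ q :=
    biSup_mono fun q hq => Or.inl hq
  have hξt : Measurable[⨆ q ∈ Q', sampleSigma ξ ζ q] fun ω i => ξ t i ω :=
    measurable_ξ_iSup fun i => ⟨rfl, rfl⟩
  have hζt : Measurable[⨆ q ∈ Q, sampleSigma ξ ζ q] fun ω i => ζ t i ω :=
    measurable_ζ_iSup fun i => Or.inr ⟨rfl, rfl⟩
  have hx : Measurable[history hξ hζ t] fun ω =>
      P.iterate C γ c x₀ (fun t i => ξ t i ω) (fun t i => ζ t i ω) t :=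
    measurable_fst.comp (measurable_state hP hE hC hξ hζ t)
  set φ : (Vec d × (∀ i, Z i) × Vec d) × (∀ i, Ξ i) → ℝ≥0∞ := fun p =>
    ENNReal.ofReal (Real.exp (inner ℝ
      (P.avgSubgrad c p.1.1 p.2 p.1.2.1 - P.meanSubgrad c p.1.1 p.1.2.1) p.1.2.2
        - M ^ 2 * ‖p.1.2.2‖ ^ 2 / 2)) with hφdef
  have hφ : Measurable φ := measurable_exp_noise hP hE
  have hφ1 : ∀ a, ∫⁻ ω, φ (a, fun i => ξ t i ω) ∂μ ≤ 1 := fun a =>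
    lintegral_exp_noise_le hn hM hP hE hB h t a.1 a.2.2 a.2.1
  have hm : ⨆ q ∈ Q, sampleSigma ξ ζ q ≤ mΩ := iSup₂_le fun q _ => hle q
  have hξm : Measurable fun ω i => ξ t i ω := measurable_pi_lambda _ fun i => hξ t i
  have hH := (hx.mono hmono le_rfl).prodMk (hζt.prodMk (hw.mono hmono le_rfl))
  have key := lintegral_mul_le_of_indep hm hξm
    (indep_of_indep_of_le_right hind hξt.comap_le) hH hφ hφ1 (hρ.mono hmono le_rfl)
  rw [mul_one] at key
  exact key

theorem measureReal_abs_estG_sub_le [IsProbabilityMeasure μ] (hn : 0 < n) (hτ : 0 < τ)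
    (hE : P.SubGaussianEval τ) (h : P.IndepSamples μ ξ ζ) (t : ℕ) (x : Vec d) {ε : ℝ}
    (hε : 0 ≤ ε) :
    μ.real {ω | ε < |P.estG x (fun i => ζ t i ω) - P.g x|}
      ≤ 2 * Real.exp (-(n * ε ^ 2 / (4 * τ))) := by
  have hprob := hE.prob_evalDistr
  set X : Fin n → Ω → ℝ := fun i ω => P.evalG i x (ζ t i ω) - P.gi i x with hX
  have hem : ∀ i, Measurable (P.evalG i x) := fun i =>
    (hE.measurable_evalG i).comp (measurable_const.prodMk measurable_id)
  have hind : iIndepFun X μ :=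
    (h.indep_pairs.precomp (g := fun i : Fin n => (t, i)) fun i j hij => (Prod.mk.inj hij).2).comp
      (fun i p => P.evalG i x p.2 - P.gi i x)
      fun i => ((hem i).comp measurable_snd).sub_const _
  have hsub : ∀ i, HasSubgaussianMGF (X i) (2 * ⟨τ, hτ.le⟩) μ := by
    intro i
    have hz := h.law_ζ t i
    have hint : Integrable (fun ω => P.evalG i x (ζ t i ω)) μ :=
      hz.integrable_comp_of_integrable (hE.integrable_evalG i x)
    refine hasSubgaussianMGF_of_lintegral_exp_sq_le hτ (hint.sub (integrable_const _))
      (((hem i).comp hz.measurable).sub_const _) ?_ ?_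
    · rw [integral_sub hint (integrable_const _)]
      have : ∫ ω, P.evalG i x (ζ t i ω) ∂μ = P.gi i x := by
        rw [← hE.unbiased i x, ← hz.map_eq, integral_map hz.measurable.aemeasurable]
        exact (hem i).aestronglyMeasurable
      rw [this]
      simp
    · have := hE.subGaussian i x
      rw [← hz.lintegral_comp] at this
      · exact this
      · exact (Real.measurable_exp.comp
          ((((hem i).sub_const _).pow_const 2).div_const _)).ennreal_ofReal
  have key := measureReal_abs_average_gt_le hn hind hsub hε
  have e : ∀ ω, (1 / (n : ℝ)) * ∑ i, X i ω = P.estG x (fun i => ζ t i ω) - P.g x := by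
    intro ω
    simp only [hX, Finset.sum_sub_distrib, estG, g, mul_sub]
  simp only [e] at key
  exact key

theorem measure_abs_estG_iterate_sub_le [IsProbabilityMeasure μ] (hn : 0 < n) (hτ : 0 < τ)
    (hP : P.StochConvex) (hE : P.SubGaussianEval τ) (h : P.IndepSamples μ ξ ζ)
    (hC : ∀ i, Measurable (C i)) (t : ℕ) {ε : ℝ} (hε : 0 ≤ ε) :
    μ {ω | ε < |P.estG (P.iterate C γ c x₀ (fun t i => ξ t i ω) (fun t i => ζ t i ω) t)
        (fun i => ζ t i ω)
      - P.g (P.iterate C γ c x₀ (fun t i => ξ t i ω) (fun t i => ζ t i ω) t)|}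
      ≤ ENNReal.ofReal (2 * Real.exp (-(n * ε ^ 2 / (4 * τ)))) := by
  have hξ : ∀ t i, Measurable (ξ t i) := fun t i => (h.law_ξ t i).measurable
  have hζ : ∀ t i, Measurable (ζ t i) := fun t i => (h.law_ζ t i).measurable
  have hle := sampleSigma_le hξ hζ
  have hdisj : Disjoint {q : Σ _ : ℕ × Fin n, Bool | q.1.1 < t} {q | q.1.1 = t} := by
    rw [Set.disjoint_left]
    exact fun q h1 h2 => h1.ne h2
  have hind := indep_iSup_of_disjoint hle h.iIndep_sampleSigma hdisj
  have hζt : Measurable[⨆ q ∈ {q : Σ _ : ℕ × Fin n, Bool | q.1.1 = t}, sampleSigma ξ ζ q]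
      fun ω i => ζ t i ω := measurable_ζ_iSup fun i => rfl
  have hx : Measurable[history hξ hζ t] fun ω =>
      P.iterate C γ c x₀ (fun t i => ξ t i ω) (fun t i => ζ t i ω) t :=
    measurable_fst.comp (measurable_state hP hE hC hξ hζ t)
  set A : Set (Vec d × (∀ i, Z i)) := {p | ε < |P.estG p.1 p.2 - P.g p.1|} with hA
  have hAm : MeasurableSet A := by
    have h1 : Measurable fun p : Vec d × (∀ i, Z i) => |P.estG p.1 p.2 - P.g p.1| :=
      (hE.measurable_estG.sub ((measurable_g hE).comp measurable_fst)).abs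
    exact h1 measurableSet_Ioi
  have hζm : Measurable fun ω i => ζ t i ω := measurable_pi_lambda _ fun i => hζ t i
  have key := lintegral_mul_le_of_indep (μ := μ) ((history hξ hζ).le t) hζm
    (indep_of_indep_of_le_right hind hζt.comap_le) hx (φ := A.indicator 1)
    (measurable_one.indicator hAm)
    (K := ENNReal.ofReal (2 * Real.exp (-(n * ε ^ 2 / (4 * τ))))) ?_ (ρ := fun _ => 1)
    measurable_const
  · simp only [one_mul, lintegral_one, measure_univ] at key
    refine le_trans (le_of_eq ?_) key
    rw [← lintegral_indicator_one]
    · rfl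
    · exact ((hx.mono ((history hξ hζ).le t) le_rfl).prodMk hζm) hAm
  · intro x
    have h1 := ENNReal.ofReal_le_ofReal (measureReal_abs_estG_sub_le hn hτ hE h t x hε)
    rw [ofReal_measureReal] at h1
    refine le_trans (le_of_eq ?_) h1
    rw [← lintegral_indicator_one]
    · rfl
    · exact (measurable_const.prodMk hζm) hAm

end Problem

end Oracles

/-! ### Convergence along a realization -/

section Convergence

universe u v

theorem map_average_le {d : ℕ} {φ : Vec d → ℝ} (hφ : ConvexOn ℝ Set.univ φ) {s : Finset ℕ}
    (hs : s.Nonempty) (x : ℕ → Vec d) :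
    φ ((1 / (s.card : ℝ)) • ∑ t ∈ s, x t) ≤ (1 / (s.card : ℝ)) * ∑ t ∈ s, φ (x t) := by
  have hc : (s.card : ℝ) ≠ 0 := by exact_mod_cast hs.card_pos.ne'
  have := hφ.map_sum_le (t := s) (w := fun _ => 1 / (s.card : ℝ)) (p := x)
    (fun _ _ => by positivity) (by simp [hc]) (fun _ _ => Set.mem_univ _)
  simpa only [← Finset.smul_sum, smul_eq_mul, ← Finset.mul_sum] using this

namespace Problem

variable {n d : ℕ} {Ξ : Fin n → Type u} {Z : Fin n → Type v}
  [∀ i, MeasurableSpace (Ξ i)] [∀ i, MeasurableSpace (Z i)]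
  {P : Problem n d Ξ Z} {C : Fin n → Vec d → Vec d}

/-- Convergence along a realization of the samples for which the subgradient noise is controlled
and the constraint evaluations are accurate up to `c / 8`. -/
theorem output_le_of_noise {T : ℕ} {γ c M δ R K B : ℝ} {x₀ xstar : Vec d}
    {ξ : ℕ → ∀ i, Ξ i} {ζ : ℕ → ∀ i, Z i} (hn : 0 < n) (hT : 0 < T) (hM : 0 ≤ M) (hδ : 0 < δ)
    (hδ1 : δ ≤ 1) (hγ : 0 < γ) (hB0 : 0 < B) (hK : 0 < K)
    (hP : P.StochConvex) (hB : P.BoundedSubgradients M) (hC : ∀ i, IsContractive δ (C i))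
    (hsol : P.IsSolution xstar) (hR : ‖x₀ - xstar‖ ≤ R) (hRK : R ^ 2 ≤ K)
    (hG : γ ^ 2 * M ^ 2 * T ≤ δ * K / 64) (hγB : γ * T * B = K / 8) (hc : c = 2048 * B)
    (hS : ∀ D, (∀ s ≤ T, ‖P.virtualIterate C γ c x₀ ξ ζ s - xstar‖ ≤ D) → ∀ t ≤ T,
      |∑ s ∈ Finset.range t, 2 * γ * inner ℝ
        (P.avgSubgrad c (P.iterate C γ c x₀ ξ ζ s) (ξ s) (ζ s)
          - P.meanSubgrad c (P.iterate C γ c x₀ ξ ζ s) (ζ s))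
        (P.virtualIterate C γ c x₀ ξ ζ s - xstar)| ≤ D ^ 2 / 32 + 2 * K)
    (hW : ∀ t ≤ T, ‖∑ s ∈ Finset.range t, γ •
        (P.avgSubgrad c (P.iterate C γ c x₀ ξ ζ s) (ξ s) (ζ s)
          - P.meanSubgrad c (P.iterate C γ c x₀ ξ ζ s) (ζ s))‖ ^ 2 ≤ 3 * K)
    (hacc : ∀ t < T, |P.estG (P.iterate C γ c x₀ ξ ζ t) (ζ t)
      - P.g (P.iterate C γ c x₀ ξ ζ t)| ≤ c / 8) :
    (P.goodSteps C γ c x₀ ξ ζ T).Nonempty ∧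
    P.f (P.output C γ c x₀ ξ ζ T) - P.f xstar ≤ 4096 * B ∧
    P.g (P.output C γ c x₀ ξ ζ T) ≤ 4096 * B := by
  have hT' : (1 : ℝ) ≤ T := by exact_mod_cast hT
  set x : ℕ → Vec d := fun t => P.iterate C γ c x₀ ξ ζ t with hx
  set good : ℕ → Prop := fun t => P.estG (x t) (ζ t) ≤ c with hgood
  classical
  set q : ℕ → ℝ := fun t => if good t then 2 * γ * (P.f (x t) - P.f xstar) else γ * c / 2 with hq
  have hc0 : 0 < c := by rw [hc]; positivity
  -- any point at which `g ≤ 9 c / 16` and `f ≤ f xstar` serves as a comparator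
  have hcomp : ∀ y, P.f y ≤ P.f xstar → P.g y ≤ 9 / 16 * c → ∀ s < T,
      q s ≤ 2 * γ * inner ℝ (P.meanSubgrad c (x s) (ζ s)) (x s - y) := by
    intro y hfy hgy s hs
    simp only [hq]
    split_ifs with h
    · have := f_sub_le_inner hM hP hB h y
      gcongr
      linarith
    · have h1 := g_sub_le_inner hM hP hB h y
      have h2 := abs_le.1 (hacc s hs)
      have h3 : c < P.estG (x s) (ζ s) := not_le.1 h
      have h4 : c / 4 ≤ inner ℝ (P.meanSubgrad c (x s) (ζ s)) (x s - y) := by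
        have := h2.2
        simp only [hx] at h1 h3 ⊢
        linarith
      calc γ * c / 2 = 2 * γ * (c / 4) := by ring
        _ ≤ _ := by gcongr
  have hup : ∀ s, P.virtualIterate C γ c x₀ ξ ζ s - xstar + γ • P.avgError C γ c x₀ ξ ζ s
      = x s - xstar := by
    intro s
    simp only [virtualIterate, hx]
    abel
  have hsum : ∑ s ∈ Finset.range T, q s ≤ 64 * K := by
    have hγM : γ ^ 2 * M ^ 2 ≤ γ ^ 2 * M ^ 2 * T := le_mul_of_one_le_right (by positivity) hT'
    have hδK : δ * K ≤ K := mul_le_of_le_one_left hK.le hδ1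
    refine sum_excess_le (γ := γ) (M := M) (r := γ ^ 2 * M ^ 2 * (1 + 4 / δ))
      (u := fun s => P.virtualIterate C γ c x₀ ξ ζ s - xstar)
      (p := fun s => γ • P.avgError C γ c x₀ ξ ζ s)
      (m := fun s => P.meanSubgrad c (x s) (ζ s))
      (z := fun s => P.avgSubgrad c (x s) (ξ s) (ζ s) - P.meanSubgrad c (x s) (ζ s))
      hγ.le hK.le (by positivity) (fun s _ => ?_) (fun s _ => ?_) (fun s _ => ?_) (fun s _ => ?_)
      ?_ (fun s hs => ?_) ?_ ?_ (fun s hs => ?_) (fun j hj hqj s hs => ?_) hS hW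
    · rw [virtualIterate_succ, add_sub_cancel]
      abel
    · rw [add_sub_cancel]
      exact hB.norm_avgSubgrad_le hn hM _ _ _
    · exact norm_meanSubgrad_le hn hM hP hB _ _
    · have h1 := (norm_avgError_le (γ := γ) (c := c) (x₀ := x₀) (ξ := ξ) (ζ := ζ)
        hn hM hB hδ hδ1 hC s).1
      rw [norm_smul, Real.norm_of_nonneg hγ.le]
      calc 2 * γ * M * (γ * ‖P.avgError C γ c x₀ ξ ζ s‖) + γ ^ 2 * M ^ 2
          ≤ 2 * γ * M * (γ * (2 * M / δ)) + γ ^ 2 * M ^ 2 := by gcongr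
        _ = γ ^ 2 * M ^ 2 * (1 + 4 / δ) := by ring
    · calc T * (γ ^ 2 * M ^ 2 * (1 + 4 / δ)) = γ ^ 2 * M ^ 2 * T * (1 + 4 / δ) := by ring
        _ ≤ δ * K / 64 * (1 + 4 / δ) := by gcongr
        _ = (δ * K + 4 * K) / 64 := by field_simp
        _ ≤ K / 8 := by linarith
    · obtain ⟨h1, h2⟩ := norm_avgError_le (γ := γ) (c := c) (x₀ := x₀) (ξ := ξ) (ζ := ζ)
        hn hM hB hδ hδ1 hC s
      rw [norm_smul, Real.norm_of_nonneg hγ.le, mul_pow]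
      have hsT : (s : ℝ) ≤ T := by exact_mod_cast hs.le
      calc γ ^ 2 * ‖P.avgError C γ c x₀ ξ ζ s‖ ^ 2
          ≤ γ ^ 2 * ((2 * M / δ) * (M * s)) := by
            rw [sq ‖P.avgError C γ c x₀ ξ ζ s‖]
            gcongr
        _ = 2 / δ * (γ ^ 2 * M ^ 2 * s) := by ring
        _ ≤ 2 / δ * (γ ^ 2 * M ^ 2 * T) := by gcongr
        _ ≤ 2 / δ * (δ * K / 64) := by gcongr
        _ = K / 32 := by field_simp; norm_num
    · linarith
    · simp only [virtualIterate_zero]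
      refine le_trans ?_ hRK
      gcongr
    · rw [hup]
      exact hcomp xstar le_rfl (hsol.1.trans (by positivity)) s hs
    · -- a step of negative excess is good, so that the midpoint of its iterate and `xstar`
      -- has `f ≤ f xstar` and `g ≤ 9 c / 16`
      have hgj : good j := by
        by_contra hgj
        simp only [hq, if_neg hgj] at hqj
        have : 0 < γ * c / 2 := by positivity
        linarith
      have hfj : P.f (x j) < P.f xstar := by
        simp only [hq, if_pos hgj] at hqj
        by_contra hfj
        have : 0 ≤ 2 * γ * (P.f (x j) - P.f xstar) :=
          mul_nonneg (by positivity) (sub_nonneg.2 (not_lt.1 hfj))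
        linarith
      rw [hup, hup]
      have e : x s - xstar - (1 / 2 : ℝ) • (x j - xstar)
          = x s - ((1 / 2 : ℝ) • x j + (1 / 2 : ℝ) • xstar) := by module
      rw [e]
      have h1 := hP.convexOn_f.2 (Set.mem_univ (x j)) (Set.mem_univ xstar)
        (by norm_num : (0 : ℝ) ≤ 1 / 2) (by norm_num : (0 : ℝ) ≤ 1 / 2) (by norm_num)
      have h2 := hP.convexOn_g.2 (Set.mem_univ (x j)) (Set.mem_univ xstar)
        (by norm_num : (0 : ℝ) ≤ 1 / 2) (by norm_num : (0 : ℝ) ≤ 1 / 2) (by norm_num)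
      simp only [smul_eq_mul] at h1 h2
      refine hcomp _ (by linarith) ?_ s hs
      have h3 := (abs_le.1 (hacc j hj)).1
      have h4 : P.estG (x j) (ζ j) ≤ c := hgj
      have h5 := hsol.1
      simp only [hx] at h2 h4
      linarith
  -- sum over the good and the bad iterations separately
  set s := P.goodSteps C γ c x₀ ξ ζ T with hs
  have hs' : s = (Finset.range T).filter good := rfl
  have hsplit : 2 * γ * ∑ t ∈ s, (P.f (x t) - P.f xstar) + (T - s.card) * (γ * c / 2)
      ≤ 64 * K := by
    refine le_trans (le_of_eq ?_) hsum
    have hcard : (((Finset.range T).filter fun t => ¬ good t).card : ℝ) = T - s.card := by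
      have := Finset.card_filter_add_card_filter_not (s := Finset.range T) good
      rw [← hs', Finset.card_range] at this
      rw [eq_sub_iff_add_eq']
      exact_mod_cast this
    rw [Finset.sum_ite, ← hs', Finset.sum_const, nsmul_eq_mul, hcard, Finset.mul_sum]
  have hγc : T * (γ * c / 2) = 128 * K := by
    rw [hc]
    linear_combination 1024 * hγB
  have hne : s.Nonempty := by
    rw [Finset.nonempty_iff_ne_empty]
    intro h0
    rw [h0] at hsplit
    simp only [Finset.sum_empty, Finset.card_empty, Nat.cast_zero, mul_zero, sub_zero] at hsplit
    linarith
  have hcard : (0 : ℝ) < s.card := by exact_mod_cast hne.card_pos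
  refine ⟨hne, ?_, ?_⟩
  · have h1 := map_average_le hP.convexOn_f hne x
    have h2 : (1 / (s.card : ℝ)) * ∑ t ∈ s, P.f (x t) - P.f xstar
        = (∑ t ∈ s, (P.f (x t) - P.f xstar)) / s.card := by
      rw [Finset.sum_sub_distrib, Finset.sum_const, nsmul_eq_mul]
      field_simp
    refine (sub_le_sub_right h1 _).trans ?_
    rw [h2, div_le_iff₀ hcard]
    rcases le_total (∑ t ∈ s, (P.f (x t) - P.f xstar)) 0 with h3 | h3
    · exact h3.trans (by positivity)
    · have h4 : (T - s.card : ℝ) * (γ * c / 2) ≤ 64 * K := by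
        have : 0 ≤ 2 * γ * ∑ t ∈ s, (P.f (x t) - P.f xstar) := by positivity
        linarith
      -- at least half of the iterations are good
      have h5 : (T : ℝ) ≤ 2 * s.card := by
        have : (T - 2 * s.card : ℝ) * (γ * c / 2) ≤ 0 := by linarith
        have h6 : 0 < γ * c / 2 := by positivity
        by_contra h7
        have := mul_pos (sub_pos.2 (not_le.1 h7)) h6
        linarith
      have h8 : (s.card : ℝ) ≤ T := by
        have := Finset.card_filter_le (Finset.range T) good
        rw [← hs', Finset.card_range] at this
        exact_mod_cast this
      have h9 : 2 * γ * ∑ t ∈ s, (P.f (x t) - P.f xstar) ≤ 2 * γ * (256 * T * B) := by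
        have : 0 ≤ (T - s.card : ℝ) * (γ * c / 2) :=
          mul_nonneg (sub_nonneg.2 h8) (by positivity)
        have e : 2 * γ * (256 * T * B) = 64 * K := by linear_combination 512 * hγB
        linarith
      have h10 := le_of_mul_le_mul_left h9 (by positivity)
      have h11 : T * B ≤ 2 * s.card * B := by gcongr
      have h12 : 0 ≤ s.card * B := by positivity
      linarith
  · refine (map_average_le hP.convexOn_g hne x).trans ?_
    rw [one_div, inv_mul_le_iff₀ hcard]
    calc ∑ t ∈ s, P.g (x t) ≤ ∑ _t ∈ s, 4096 * B := by
          refine Finset.sum_le_sum fun t ht => ?_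
          rw [hs', Finset.mem_filter, Finset.mem_range] at ht
          have h1 := (abs_le.1 (hacc t ht.1)).1
          have h2 : P.estG (x t) (ζ t) ≤ c := ht.2
          simp only [hx] at h2 ⊢
          linarith
      _ = s.card * (4096 * B) := by rw [Finset.sum_const, nsmul_eq_mul]

end Problem

end Convergence

/-! ### Convergence with high probability -/

section HighProbability

universe u v

namespace Problem

variable {n d : ℕ} {Ξ : Fin n → Type u} {Z : Fin n → Type v}
  [∀ i, MeasurableSpace (Ξ i)] [∀ i, MeasurableSpace (Z i)]
  {P : Problem n d Ξ Z} {C : Fin n → Vec d → Vec d}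
  {Ω : Type*} {mΩ : MeasurableSpace Ω} {μ : Measure Ω}
  {ξ : ℕ → ∀ i, Ω → Ξ i} {ζ : ℕ → ∀ i, Ω → Z i}

/-- With a large batch all constraint evaluations are accurate up to `c / 8`. -/
theorem measure_exists_inaccurate_le [IsProbabilityMeasure μ] {T N : ℕ} {γ c σ β : ℝ} {x₀ : Vec d}
    (hn : 0 < n) (hT : 0 < T) (hN : 0 < N) (hσ : 0 < σ) (hβ : 0 < β) (hc : 0 < c)
    (hbatch : 256 * (1 + Real.log (T / β)) * (σ ^ 2 / (n * c ^ 2)) ≤ N)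
    (hP : P.StochConvex) (hE : P.SubGaussianEval (σ ^ 2 / N)) (hC : ∀ i, Measurable (C i))
    (h : P.IndepSamples μ ξ ζ) :
    μ {ω | ∃ t < T, c / 8 <
      |P.estG (P.iterate C γ c x₀ (fun t i => ξ t i ω) (fun t i => ζ t i ω) t)
        (fun i => ζ t i ω)
      - P.g (P.iterate C γ c x₀ (fun t i => ξ t i ω) (fun t i => ζ t i ω) t)|}
      ≤ ENNReal.ofReal β := by
  have hn' : (0 : ℝ) < n := by exact_mod_cast hn
  have hN' : (0 : ℝ) < N := by exact_mod_cast hN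
  have hT' : (0 : ℝ) < T := by exact_mod_cast hT
  have htail : 2 * Real.exp (-(n * (c / 8) ^ 2 / (4 * (σ ^ 2 / N)))) ≤ β / T := by
    have h1 : 1 + Real.log (T / β) ≤ n * (c / 8) ^ 2 / (4 * (σ ^ 2 / N)) := by
      rw [mul_div_assoc', div_le_iff₀ (by positivity)] at hbatch
      rw [le_div_iff₀ (by positivity), mul_div_assoc', mul_div_assoc', div_le_iff₀ hN']
      linarith
    have h2 : (2 : ℝ) ≤ Real.exp 1 := by linarith [Real.add_one_le_exp 1]
    calc 2 * Real.exp (-(n * (c / 8) ^ 2 / (4 * (σ ^ 2 / N))))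
        ≤ Real.exp 1 * Real.exp (-(1 + Real.log (T / β))) := by gcongr
      _ = β / T := by
        rw [← Real.exp_add, show 1 + -(1 + Real.log (T / β)) = -Real.log (T / β) by ring,
          Real.exp_neg, Real.exp_log (by positivity), inv_div]
  have hset : {ω | ∃ t < T, c / 8 <
      |P.estG (P.iterate C γ c x₀ (fun t i => ξ t i ω) (fun t i => ζ t i ω) t)
        (fun i => ζ t i ω)
      - P.g (P.iterate C γ c x₀ (fun t i => ξ t i ω) (fun t i => ζ t i ω) t)|}
      = ⋃ t ∈ Finset.range T, {ω | c / 8 <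
      |P.estG (P.iterate C γ c x₀ (fun t i => ξ t i ω) (fun t i => ζ t i ω) t)
        (fun i => ζ t i ω)
      - P.g (P.iterate C γ c x₀ (fun t i => ξ t i ω) (fun t i => ζ t i ω) t)|} := by
    ext ω
    simp
  rw [hset]
  calc _ ≤ ∑ t ∈ Finset.range T, ENNReal.ofReal (β / T) := by
        refine (measure_biUnion_finset_le _ _).trans (Finset.sum_le_sum fun t _ => ?_)
        exact (measure_abs_estG_iterate_sub_le hn (by positivity) hP hE h hC t
          (by positivity)).trans (ENNReal.ofReal_le_ofReal htail)
    _ = ENNReal.ofReal β := by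
        rw [← ENNReal.ofReal_sum_of_nonneg fun _ _ => by positivity]
        congr 1
        simp only [Finset.sum_const, Finset.card_range, nsmul_eq_mul]
        field_simp

end Problem

theorem one_sub_le_measureReal {Ω : Type*} {mΩ : MeasurableSpace Ω} {μ : Measure Ω}
    [IsProbabilityMeasure μ] {A B G : Set Ω} {β : ℝ} (hβ : 0 ≤ β) (hA : μ A ≤ ENNReal.ofReal β)
    (hB : μ B ≤ ENNReal.ofReal β) (hG : ∀ ω, ω ∉ A → ω ∉ B → ω ∈ G) : 1 - 2 * β ≤ μ.real G := by
  have hcover : (Set.univ : Set Ω) ⊆ G ∪ (A ∪ B) := fun ω _ => by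
    by_cases h1 : ω ∈ A
    · exact Or.inr (Or.inl h1)
    · by_cases h2 : ω ∈ B
      · exact Or.inr (Or.inr h2)
      · exact Or.inl (hG ω h1 h2)
  have hA' : μ.real A ≤ β := ENNReal.toReal_le_of_le_ofReal hβ hA
  have hB' : μ.real B ≤ β := ENNReal.toReal_le_of_le_ofReal hβ hB
  have h1 : μ.real Set.univ ≤ μ.real G + (μ.real A + μ.real B) :=
    (measureReal_mono hcover).trans ((measureReal_union_le _ _).trans
      (add_le_add le_rfl (measureReal_union_le _ _)))
  rw [probReal_univ] at h1
  linarith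

end HighProbability

end SafeEF

theorem theorem3 :
    -- absolute constants
    ∃ κγ κc κN κ : ℝ, 0 < κγ ∧ 0 < κc ∧ 0 < κN ∧ 0 < κ ∧
    ∀ (n d T N : ℕ) (R M σ δ β γ c : ℝ),
      0 < n → 0 < T → 0 < N → 0 < M → 0 < σ → 0 < δ → δ ≤ 1 → 0 < β → β < 1 / 2 →
      -- the stepsize and the threshold
      γ = κγ * ((M * R + σ / √N) * √δ / (M ^ 2 * √T)) →
      c = κc * ((M * R + σ / √N) * (1 + Real.log (1 / β)) / √(δ * T)) →
      -- the batch size is large enough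
      κN * (1 + Real.log (T / β)) * (σ ^ 2 / (n * c ^ 2)) ≤ N →
      ∀ (Ξ : Fin n → Type*) (Z : Fin n → Type*)
        [∀ i, MeasurableSpace (Ξ i)] [∀ i, MeasurableSpace (Z i)]
        (P : SafeEF.Problem n d Ξ Z) (C : Fin n → SafeEF.Vec d → SafeEF.Vec d)
        (x₀ xstar : SafeEF.Vec d)
        (Ω : Type*) [MeasurableSpace Ω] (μ : MeasureTheory.Measure Ω)
        [MeasureTheory.IsProbabilityMeasure μ]
        (ξ : ℕ → ∀ i, Ω → Ξ i) (ζ : ℕ → ∀ i, Ω → Z i),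
        P.StochConvex → P.BoundedSubgradients M → P.SubGaussianEval (σ ^ 2 / N) →
        (∀ i, Measurable (C i) ∧ SafeEF.IsContractive δ (C i)) →
        P.IsSolution xstar → ‖x₀ - xstar‖ ≤ R →
        P.IndepSamples μ ξ ζ →
        1 - 2 * β ≤ μ.real {ω |
          (P.goodSteps C γ c x₀ (fun t i => ξ t i ω) (fun t i => ζ t i ω) T).Nonempty ∧
          P.f (P.output C γ c x₀ (fun t i => ξ t i ω) (fun t i => ζ t i ω) T) - P.f xstar
            ≤ κ * ((M * R + σ / √N) * (1 + Real.log (1 / β)) / √(δ * T)) ∧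
          P.g (P.output C γ c x₀ (fun t i => ξ t i ω) (fun t i => ζ t i ω) T)
            ≤ κ * ((M * R + σ / √N) * (1 + Real.log (1 / β)) / √(δ * T))} := by
  -- With `K = V * L`: `κγ = 1 / 8` makes `γ² M² T ≤ K / 64`, so that drift, compression error and
  -- noise are of order `K`; then the excess sum is at most `64 K`, while a bad step adds `γ c / 2`
  -- and `κc = 2048` makes `T γ c / 2 = 128 K`, so at least half of the steps are good.
  refine ⟨1 / 8, 2048, 256, 4096, by norm_num, by norm_num, by norm_num, by norm_num, ?_⟩
  intro n d T N R M σ δ β γ c hn hT hN hM hσ hδ hδ1 hβ hβ2 hγ hc hbatch Ξ Z _ _ P C x₀ xstar Ω _ μ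
    _ ξ ζ hP hB hE hC hsol hR hind
  have hN' : (0 : ℝ) < N := by exact_mod_cast hN
  have hT' : (0 : ℝ) < T := by exact_mod_cast hT
  have hR0 : 0 ≤ R := (norm_nonneg _).trans hR
  set Λ : ℝ := M * R + σ / √N with hΛ
  set L : ℝ := 1 + Real.log (1 / β) with hL
  set V : ℝ := (Λ / M) ^ 2 with hV
  have hΛ0 : 0 < Λ := by positivity
  have hlog : 0 ≤ Real.log (1 / β) := Real.log_nonneg (by rw [le_div_iff₀ hβ]; linarith)
  have hL1 : 1 ≤ L := by linarith
  have hV0 : 0 < V := by positivity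
  have hVK : V ≤ V * L := le_mul_of_one_le_right hV0.le hL1
  have hγ0 : 0 < γ := by rw [hγ]; positivity
  have hB0 : 0 < Λ * L / √(δ * T) := by positivity
  have hc0 : 0 < c := by rw [hc]; positivity
  have hlog3 : Real.log (3 / β) ≤ 2 * L := by
    have h3 : Real.log 3 ≤ 2 := by linarith [Real.log_le_sub_one_of_pos (by norm_num : (0 : ℝ) < 3)]
    rw [div_eq_mul_one_div, Real.log_mul (by norm_num) (by positivity)]
    linarith
  have hGV : γ ^ 2 * M ^ 2 * T = δ * V / 64 := by
    have h1 := Real.sq_sqrt hδ.le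
    have h2 := Real.sq_sqrt hT'.le
    rw [hγ, hV]
    simp only [div_pow, mul_pow, h1, h2]
    field_simp
    norm_num
  have hγB : γ * T * (Λ * L / √(δ * T)) = V * L / 8 := by
    have h2 := Real.sq_sqrt hT'.le
    rw [hγ, hV, Real.sqrt_mul hδ.le]
    field_simp
    rw [h2]
  have hδV : δ * V ≤ V := mul_le_of_le_one_left hV0.le hδ1
  have hξ : ∀ t i, Measurable (ξ t i) := fun t i => (hind.law_ξ t i).measurable
  have hζ : ∀ t i, Measurable (ζ t i) := fun t i => (hind.law_ζ t i).measurable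
  have hCm := fun i => (hC i).1
  have hstate := SafeEF.Problem.measurable_state (γ := γ) (c := c) (x₀ := x₀) hP hE hCm hξ hζ
  have hxm : ∀ t, Measurable[SafeEF.Problem.history hξ hζ t] fun ω =>
      P.iterate C γ c x₀ (fun t i => ξ t i ω) (fun t i => ζ t i ω) t := fun t =>
    measurable_fst.comp (hstate t)
  have hnoise := (SafeEF.Problem.condSubgaussian_noise (c := c) (γ := γ) (x₀ := x₀) hn hM.le hP hE
    hB hind hCm hξ hζ).measure_not_noise_le (γ := γ) (V := V) (T := T) (β := β)
    (u := fun t ω =>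
      P.virtualIterate C γ c x₀ (fun t i => ξ t i ω) (fun t i => ζ t i ω) t - xstar)
    hT hV0 hβ (fun t => ?_) (fun t ω => ?_) (fun t => ?_) (by linarith)
  · have hacc := SafeEF.Problem.measure_exists_inaccurate_le (γ := γ) (x₀ := x₀) hn hT hN hσ hβ hc0
      hbatch hP hE hCm hind
    refine SafeEF.one_sub_le_measureReal hβ.le hnoise hacc fun ω h1 h2 => ?_
    obtain ⟨hS, hW⟩ := not_not.1 h1
    refine SafeEF.Problem.output_le_of_noise (K := V * L) hn hT hM.le hδ hδ1 hγ0 hB0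
      (by positivity) hP hB (fun i => (hC i).2) hsol hR ?_ ?_ hγB hc ?_ ?_ ?_
    · refine le_trans ?_ hVK
      rw [hV]
      gcongr
      rw [le_div_iff₀ hM, mul_comm, hΛ]
      exact le_add_of_nonneg_right (by positivity)
    · rw [hGV]
      gcongr
    · intro D hD t ht
      refine (hS D hD t ht).trans ?_
      nlinarith
    · intro t ht
      refine (hW t ht).trans ?_
      nlinarith
    · intro t ht
      by_contra h
      exact h2 ⟨t, ht, not_le.1 h⟩
  · have hx := (hxm t).mono ((SafeEF.Problem.history hξ hζ).mono t.le_succ) le_rfl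
    have h2 : Measurable[SafeEF.Problem.history hξ hζ (t + 1)] fun ω i => ξ t i ω :=
      SafeEF.Problem.measurable_ξ_iSup fun i => t.lt_succ_self
    have h3 : Measurable[SafeEF.Problem.history hξ hζ (t + 1)] fun ω i => ζ t i ω :=
      SafeEF.Problem.measurable_ζ_iSup fun i => t.lt_succ_self
    exact ((SafeEF.Problem.measurable_avgSubgrad (c := c) hP hE).comp
      (hx.prodMk (h2.prodMk h3))).sub
      ((SafeEF.Problem.measurable_meanSubgrad (c := c) hP hE).comp (hx.prodMk h3))
  · have h1 := hB.norm_avgSubgrad_le hn hM.le (c := c)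
      (P.iterate C γ c x₀ (fun t i => ξ t i ω) (fun t i => ζ t i ω) t)
      (fun i => ξ t i ω) (fun i => ζ t i ω)
    have h2 := SafeEF.Problem.norm_meanSubgrad_le (c := c) hn hM.le hP hB
      (P.iterate C γ c x₀ (fun t i => ξ t i ω) (fun t i => ζ t i ω) t) (fun i => ζ t i ω)
    exact (norm_sub_le _ _).trans (by linarith)
  · have he : Measurable fun e : Fin n → SafeEF.Vec d => (1 / (n : ℝ)) • ∑ i, e i := by fun_prop
    exact ((hxm t).sub ((he.comp (measurable_snd.comp (hstate t))).const_smul γ)).sub_const _
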